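/- Let $d\ge 1$, let $K\subset\mathbb R^d$ be a convex body with non-empty interior, and let $p>\tfrac12$. Let $N_p$ be a Poisson point process on $\mathbb R^d\times(0,\infty)$ (identified with its counting measure) with intensity measure $\nu_p(dx,dr)=dx\,r^{-d-1+2p}\,dr$, and for $C>0$ put $$\eta_{C,p}(z)=\int_{\mathbb R^d\times[0,C]}\bigl(\mathbf 1_{z\in x+rK}-\mathbf 1_{0\in x+rK}\bigr)\,N_p(dx,dr),\qquad z\in\mathbb R^d .$$ A star body is a non-empty closed bounded set $F\subset\mathbb R^d$ such that $tu$ lies in the interior of $F$ for all $u\in F$ and $0\le t<1$, and such that $\|u\|_F=\inf\{s\ge 0:u\in sF\}$ is continuous in $u\in\mathbb R^d$. The Minkowski fractional Brownian field (MfBf) with Hurst parameter $H\in(0,1]$ and associated star body $F$ is the centred Gaussian field $X_F(z)$, $z\in\mathbb R^d$, with covariance $\mathbb E[X_F(z_1)X_F(z_2)]=\tfrac12\bigl[\|z_1\|_F^{2H}+\|z_2\|_F^{2H}-\|z_1-z_2\|_F^{2H}\bigr]$. The projection body $\Pi K$ is the convex body whose support function at each unit vector $u$ equals the $(d-1)$-dimensional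 volume of the orthogonal projection of $K$ onto $u^\perp$, and $\Pi^*K=\{u:\langle x,u\rangle\le 1\text{ for all }x\in\Pi K\}$ is its polar body. Then, for every $C>0$ and $z\in\mathbb R^d$, the integral $\eta_{C,p}(z)$ converges absolutely almost surely; the MfBf with Hurst parameter $H=\tfrac12$ and associated star body $F=(p-\tfrac12)\,\Pi^*K$ exists; and, as $C\to\infty$, the finite-dimensional distributions of the random field $C^{1/2-p}\eta_{C,p}(z)$, $z\in\mathbb R^d$, converge weakly to those of this MfBf. -/

import Mathlib

open MeasureTheory ProbabilityTheory Filter Set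
open scoped Pointwise ENNReal RealInnerProductSpace

/-- The Euclidean space `ℝᵈ`. -/
abbrev Rd (d : ℕ) : Type := EuclideanSpace ℝ (Fin d)

noncomputable section

/-! ### Star bodies, polar sets and projection bodies -/

/-- Star bodies: closed bounded (non-empty) sets `F` such that for `u ∈ F` the half-open segment
`{t u : 0 ≤ t < 1}` lies in the interior of `F`, and such that the Minkowski functional
`‖u‖_F = inf {s : u ∈ s F}` is continuous. -/
structure IsStarBody {d : ℕ} (F : Set (Rd d)) : Prop where
  nonempty : F.Nonempty
  isClosed : IsClosed F
  isBounded : Bornology.IsBounded F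
  smul_mem_interior : ∀ u ∈ F, ∀ t : ℝ, 0 ≤ t → t < 1 → t • u ∈ interior F
  continuous_gauge : Continuous (gauge F)

/-- The support function `h(L, u) = sup {⟨x, u⟩ : x ∈ L}`, with values in `[-∞, ∞]`. -/
def supportFunction {d : ℕ} (L : Set (Rd d)) (u : Rd d) : EReal :=
  ⨆ x ∈ L, ((⟪x, u⟫ : ℝ) : EReal)

/-- The polar set `L* = {u : h(L, u) ≤ 1}`. -/
def polarSet {d : ℕ} (L : Set (Rd d)) : Set (Rd d) :=
  {u | supportFunction L u ≤ 1}

/-- `(d-1)`-dimensional Lebesgue measure on the hyperplane `u^⊥` (for `u ≠ 0`): the Haar measure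
giving mass one to the unit cube spanned by an orthonormal basis of `u^⊥`. -/
def hyperplaneVolume {d : ℕ} (u : Rd d) : Measure ((ℝ ∙ u)ᗮ : Submodule ℝ (Rd d)) :=
  (stdOrthonormalBasis ℝ ((ℝ ∙ u)ᗮ : Submodule ℝ (Rd d))).toBasis.addHaar

/-- `b_K(u)`: the `(d-1)`-dimensional volume of the orthogonal projection of `K` onto `u^⊥`. -/
def projectionVolume {d : ℕ} (K : Set (Rd d)) (u : Rd d) : ℝ :=
  (hyperplaneVolume u ((ℝ ∙ u)ᗮ.orthogonalProjectionOnto '' K)).toReal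

/-- The projection body `Π K`: the convex body whose support function equals `b_K` on the unit
sphere. A closed convex set is the intersection of its supporting half-spaces
`{x : ⟨x, u⟩ ≤ h(u)}`, `‖u‖ = 1`. -/
def projectionBody {d : ℕ} (K : Set (Rd d)) : Set (Rd d) :=
  {x | ∀ u : Rd d, ‖u‖ = 1 → ⟪x, u⟫ ≤ projectionVolume K u}

/-- The polar projection body `Π* K`. -/
def polarProjectionBody {d : ℕ} (K : Set (Rd d)) : Set (Rd d) :=
  polarSet (projectionBody K)

/-! ### The Minkowski fractional Brownian field -/

/-- `X` is a Minkowski fractional Brownian field with Hurst parameter `H` and associated star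
body `F`: a centred Gaussian field on `ℝᵈ` with covariance
`½ (‖z₁‖_F^{2H} + ‖z₂‖_F^{2H} - ‖z₁ - z₂‖_F^{2H})`. -/
structure IsMfBf {d : ℕ} (H : ℝ) (F : Set (Rd d)) {Ω : Type*} [MeasurableSpace Ω]
    (X : Rd d → Ω → ℝ) (P : Measure Ω) : Prop where
  hurst_pos : 0 < H
  hurst_le_one : H ≤ 1
  isStarBody : IsStarBody F
  isGaussianProcess : IsGaussianProcess X P
  centred : ∀ z, ∫ ω, X z ω ∂P = 0
  covariance_eq : ∀ z₁ z₂, ∫ ω, X z₁ ω * X z₂ ω ∂P =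
    1 / 2 * (gauge F z₁ ^ (2 * H) + gauge F z₂ ^ (2 * H) - gauge F (z₁ - z₂) ^ (2 * H))

/-! ### Poisson processes and the truncated fractional Poisson field -/

/-- `N` is a Poisson point process on `S` with intensity measure `ν`, identified with the
corresponding random counting measure. -/
structure IsPoissonProcess {S : Type*} [MeasurableSpace S] {Ω : Type*} [MeasurableSpace Ω]
    (N : Ω → Measure S) (ν : Measure S) (P : Measure Ω) : Prop where
  measurable : Measurable N
  counting : ∀ᵐ ω ∂P, ∃ (ι : Type) (_ : Countable ι) (x : ι → S),
    N ω = Measure.sum fun i => Measure.dirac (x i)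
  poisson : ∀ A, MeasurableSet A → ν A ≠ ∞ →
    P.map (fun ω => N ω A) =
      (poissonMeasure (ν A).toNNReal).map (fun n : ℕ => (n : ℝ≥0∞))
  infinite : ∀ A, MeasurableSet A → ν A = ∞ → ∀ᵐ ω ∂P, N ω A = ∞
  indep : ∀ (n : ℕ) (A : Fin n → Set S), (∀ i, MeasurableSet (A i)) →
    Pairwise (fun i j => Disjoint (A i) (A j)) → iIndepFun (fun i ω => N ω (A i)) P

/-- The intensity measure `ν_p(dx, dr) = dx r^{-d-1+2p} dr` on `ℝᵈ × (0, ∞)`, as a measure on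
`ℝᵈ × ℝ` carried by `{(x, r) : r > 0}`. -/
def poissonIntensity (d : ℕ) (p : ℝ) : Measure (Rd d × ℝ) :=
  (volume : Measure (Rd d)).prod
    (((volume : Measure ℝ).restrict (Ioi 0)).withDensity
      fun r => ENNReal.ofReal (r ^ (-(d : ℝ) - 1 + 2 * p)))

/-- The integrand `(x, r) ↦ 1{z ∈ x + r K} - 1{0 ∈ x + r K}`. -/
def fieldIntegrand {d : ℕ} (K : Set (Rd d)) (z : Rd d) (y : Rd d × ℝ) : ℝ :=
  (y.1 +ᵥ y.2 • K).indicator (fun _ => (1 : ℝ)) z -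
    (y.1 +ᵥ y.2 • K).indicator (fun _ => (1 : ℝ)) 0

/-- The field `η_C(z) = ∫_{ℝᵈ × [0, C]} (1{z ∈ x + r K} - 1{0 ∈ x + r K}) N(dx, dr)`. -/
def truncatedField {d : ℕ} (K : Set (Rd d)) {Ω : Type*} (N : Ω → Measure (Rd d × ℝ)) (C : ℝ)
    (z : Rd d) (ω : Ω) : ℝ :=
  ∫ y in univ ×ˢ Icc 0 C, fieldIntegrand K z y ∂(N ω)

end

/-! ### Integrals of simple functions against a Poisson process -/

namespace IsPoissonProcess

variable {S Ω : Type*} [MeasurableSpace S] [MeasurableSpace Ω] {N : Ω → Measure S}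
  {ν : Measure S} {P : Measure Ω}

/-! For fixed `C`, a linear combination of values of the field is the integral of one bounded simple
function `f` against the Poisson process, so with `a = C ^ (1/2 - p)` its rescaling has
characteristic function `exp (∫ (exp (i a f) - 1) dν)` (`integral_exp_integral_simpleFunc`). Here
`f` is bounded by a constant independent of `C` and has `ν`-mean zero. A Taylor expansion gives the
exponent `-a² ∫ f² / 2` with an error of at most a constant times `a · a² ∫ f²`. As `a → 0`, a
Gaussian limit follows once `a² ∫ f²` converges.

The second moments reduce, by polarization of indicators, to the intensity of grains covering
exactly one of two points `z`, `w`. Fubini turns each one-sided intensity into `∫₀^C r^(2p-2) · (r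
g((w-z)/r)) dr`, where `g(v)` is the volume of the points of `K` leaving `K` under the shift `v`.
The geometric input is Matheron's derivative of the covariogram at the origin: `r g(v/r)` tends to
`‖v‖` times the volume of the projection of `K` along `v` (`tendsto_shiftDefect_smul`). A weighted
Cesàro mean then produces the factor `1/(2p-1)` on each side.

This limit is a norm, because `g` is even and subadditive. By Hahn-Banach it is the support function
of `ΠK`, so it is the gauge of `Π*K`. Positive semidefiniteness of the limiting covariance comes for
free, as a limit of second moments, and yields the Gaussian field through a reproducing kernel space
and an isonormal process. -/

lemma measurable_apply (hN : IsPoissonProcess N ν P) {A : Set S} (hA : MeasurableSet A) :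
    Measurable fun ω => N ω A :=
  (Measure.measurable_coe hA).comp hN.measurable

lemma ae_apply_lt_top (hN : IsPoissonProcess N ν P) {A : Set S} (hA : MeasurableSet A)
    (hν : ν A ≠ ∞) : ∀ᵐ ω ∂P, N ω A < ∞ := by
  have h : ∀ᵐ x ∂(P.map fun ω => N ω A), x < ∞ := by
    rw [hN.poisson A hA hν, ae_map_iff .of_discrete (measurableSet_lt (by fun_prop) (by fun_prop))]
    exact ae_of_all _ fun n => ENNReal.natCast_lt_top n
  exact ae_of_ae_map (hN.measurable_apply hA).aemeasurable h

lemma charFun_apply (hN : IsPoissonProcess N ν P) {A : Set S} (hA : MeasurableSet A)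
    (hν : ν A ≠ ∞) (t : ℝ) :
    charFun (P.map fun ω => (N ω).real A) t =
      Complex.exp (ν.real A * (Complex.exp (t * Complex.I) - 1)) := by
  have h : (P.map fun ω => (N ω).real A) =
      (poissonMeasure (ν A).toNNReal).map (fun n : ℕ => (n : ℝ)) := by
    have : (fun ω => (N ω).real A) = ENNReal.toReal ∘ fun ω => N ω A := rfl
    rw [this, ← Measure.map_map ENNReal.measurable_toReal (hN.measurable_apply hA),
      hN.poisson A hA hν, Measure.map_map ENNReal.measurable_toReal .of_discrete]
    rfl
  rw [h, charFun_map_cast_poissonMeasure]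
  rfl

/-- Integrability of a simple function only says that its nonzero level sets have finite measure.
This passes almost surely from `ν` to `N`, as there are finitely many levels. -/
lemma ae_integrable_simpleFunc (hN : IsPoissonProcess N ν P) {f : SimpleFunc S ℝ}
    (hf : Integrable f ν) : ∀ᵐ ω ∂P, Integrable f (N ω) := by
  rw [SimpleFunc.integrable_iff] at hf
  have : ∀ y ∈ f.range, ∀ᵐ ω ∂P, y ≠ 0 → N ω (f ⁻¹' {y}) < ∞ := by
    intro y _
    by_cases hy : y = 0
    · simp [hy]
    · filter_upwards [hN.ae_apply_lt_top (f.measurableSet_fiber y) (hf y hy).ne] with ω h _ using h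
  filter_upwards [(ae_ball_iff f.range.countable_toSet).2 this] with ω hω
  rw [SimpleFunc.integrable_iff]
  intro y hy
  by_cases hyr : y ∈ f.range
  · exact hω y hyr hy
  · rw [f.preimage_eq_empty_iff y |>.2 (by simpa using hyr)]
    simp

lemma ae_integral_simpleFunc_eq (hN : IsPoissonProcess N ν P) {f : SimpleFunc S ℝ}
    (hf : Integrable f ν) :
    (fun ω => ∫ x, f x ∂(N ω)) =ᵐ[P]
      fun ω => ∑ y ∈ f.range with y ≠ 0, y * (N ω).real (f ⁻¹' {y}) := by
  filter_upwards [hN.ae_integrable_simpleFunc hf] with ω hω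
  rw [← f.integral_eq_integral hω, SimpleFunc.integral_eq_sum_filter]
  exact Finset.sum_congr rfl fun y _ => by rw [smul_eq_mul, mul_comm]

lemma aemeasurable_integral_simpleFunc (hN : IsPoissonProcess N ν P) {f : SimpleFunc S ℝ}
    (hf : Integrable f ν) : AEMeasurable (fun ω => ∫ x, f x ∂(N ω)) P := by
  refine AEMeasurable.congr ?_ (hN.ae_integral_simpleFunc_eq hf).symm
  refine (Finset.measurable_fun_sum _ fun y _ => ?_).aemeasurable
  exact (hN.measurable_apply (f.measurableSet_fiber y)).ennreal_toReal.const_mul y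

lemma iIndepFun_real (hN : IsPoissonProcess N ν P) {ι : Type*} [Fintype ι] {A : ι → Set S}
    (hA : ∀ i, MeasurableSet (A i)) (hd : Pairwise fun i j => Disjoint (A i) (A j)) :
    iIndepFun (fun i ω => (N ω).real (A i)) P := by
  let e := Fintype.equivFin ι
  have h := hN.indep _ (fun j => A (e.symm j)) (fun j => hA _)
    (fun i j hij => hd (e.symm.injective.ne hij))
  have h2 := (h.comp (fun _ => ENNReal.toReal) fun _ => ENNReal.measurable_toReal).precomp
    e.injective
  convert h2 using 2 with i
  ext ω
  simp [Measure.real]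

/-- The Laplace functional formula for simple functions. -/
lemma integral_exp_integral_simpleFunc (hN : IsPoissonProcess N ν P) [IsProbabilityMeasure P]
    {f : SimpleFunc S ℝ} (hf : Integrable f ν) :
    ∫ ω, Complex.exp ((∫ x, f x ∂(N ω) : ℝ) * Complex.I) ∂P =
      Complex.exp (∫ x, (Complex.exp (f x * Complex.I) - 1) ∂ν) := by
  have hfin := SimpleFunc.integrable_iff.1 hf
  -- The level `0` must be dropped: its level set may have infinite intensity, and it contributes
  -- nothing to either side.
  set T : Finset ℝ := {y ∈ f.range | y ≠ 0} with hT
  have hT0 : ∀ y : T, (y : ℝ) ≠ 0 := fun y => (Finset.mem_filter.1 y.2).2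
  have hind : iIndepFun (fun (y : T) ω => (y : ℝ) * (N ω).real (f ⁻¹' {(y : ℝ)})) P :=
    (hN.iIndepFun_real (fun y : T => f.measurableSet_fiber (y : ℝ)) (fun i j hij => by
      refine Disjoint.preimage _ (disjoint_singleton.2 fun h => hij (Subtype.ext h)))).comp
      (fun y x => (y : ℝ) * x) fun y => measurable_const_mul _
  have hm : ∀ y : ℝ, Measurable fun ω => (N ω).real (f ⁻¹' {y}) := fun y =>
    (hN.measurable_apply (f.measurableSet_fiber y)).ennreal_toReal
  have hsum := hind.charFun_map_fun_sum_eq_prod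
    (fun y : T => ((hm y).const_mul (y : ℝ)).aemeasurable)
  have h1 : ∫ ω, Complex.exp ((∫ x, f x ∂(N ω) : ℝ) * Complex.I) ∂P =
      charFun (P.map fun ω => ∑ y : T, (y : ℝ) * (N ω).real (f ⁻¹' {(y : ℝ)})) 1 := by
    rw [charFun_apply_real, integral_map
      (Finset.measurable_fun_sum _ fun (y : T) _ => (hm y).const_mul (y : ℝ)).aemeasurable
      (by fun_prop)]
    refine integral_congr_ae ?_
    filter_upwards [hN.ae_integral_simpleFunc_eq hf] with ω hω
    rw [hω, Finset.sum_coe_sort T fun y => y * (N ω).real (f ⁻¹' {y})]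
    simp [hT]
  let g : SimpleFunc S ℂ := f.map fun y : ℝ => Complex.exp (y * Complex.I) - 1
  have hg : Integrable g ν := by
    rw [SimpleFunc.integrable_iff_finMeasSupp] at hf ⊢
    exact hf.map (by simp)
  have h2 : ∫ x, (Complex.exp (f x * Complex.I) - 1) ∂ν =
      ∑ y : T, (ν.real (f ⁻¹' {(y : ℝ)}) : ℂ) * (Complex.exp ((y : ℝ) * Complex.I) - 1) := by
    have h3 : ∫ x, (Complex.exp (f x * Complex.I) - 1) ∂ν = ∫ x, g x ∂ν := rfl
    rw [h3, ← g.integral_eq_integral hg, SimpleFunc.map_integral _ _ hf (by simp),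
      Finset.sum_coe_sort T
        (fun y => (ν.real (f ⁻¹' {y}) : ℂ) * (Complex.exp (y * Complex.I) - 1)), hT,
      Finset.sum_filter]
    refine Finset.sum_congr rfl fun y _ => ?_
    by_cases hy : y = 0
    · simp [hy]
    · simp [hy]
  rw [h1, hsum, Finset.prod_apply, h2, Complex.exp_sum]
  refine Finset.prod_congr rfl fun y _ => ?_
  rw [charFun_map_mul_comp (hm y).aemeasurable, mul_one,
    hN.charFun_apply (f.measurableSet_fiber _) (hfin _ (hT0 y)).ne]

end IsPoissonProcess

/-! ### Existence of centred Gaussian processes with a given covariance -/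

/-- A real positive semidefinite kernel is the Gram kernel of a family in a Hilbert space. -/
lemma exists_gram_of_posSemidef {T : Type} (k : T → T → ℝ) (hsymm : ∀ s t, k s t = k t s)
    (hpos : ∀ c : T →₀ ℝ, 0 ≤ c.sum fun s a => c.sum fun t b => a * b * k s t) :
    ∃ (H : Type) (_ : NormedAddCommGroup H) (_ : InnerProductSpace ℝ H) (_ : CompleteSpace H)
      (h : T → H), ∀ s t, ⟪h s, h t⟫ = k s t := by
  -- The scalar kernel is read as an operator-valued one on `ℝ`; the vectors sought are its kernel
  -- functions applied to `1`.
  let K : Matrix T T (ℝ →L[ℝ] ℝ) := fun s t => k s t • ContinuousLinearMap.id ℝ ℝ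
  have hK : K.PosSemidef := by
    refine ((RKHS.posSemidef_tfae (K := K)).out 0 2).2 (And.intro ?_ fun c => ?_)
    · ext1 s t
      have h : k t s • ContinuousLinearMap.id ℝ ℝ =
          ContinuousLinearMap.adjoint (k t s • ContinuousLinearMap.id ℝ ℝ) := by
        rw [ContinuousLinearMap.eq_adjoint_iff]
        intro x y
        simp
        ring
      rw [Matrix.conjTranspose_apply, ContinuousLinearMap.star_eq_adjoint]
      change ContinuousLinearMap.adjoint (k t s • ContinuousLinearMap.id ℝ ℝ) =
        k s t • ContinuousLinearMap.id ℝ ℝ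
      rw [← h, hsymm]
    · have := hpos c
      simp only [RCLike.re_to_real]
      refine this.trans_eq (Finset.sum_congr rfl fun s _ => Finset.sum_congr rfl fun t _ => ?_)
      simp [K, hsymm t s]
      ring
  have : Fact K.PosSemidef := ⟨hK⟩
  refine ⟨RKHS.OfKernel K, inferInstance, inferInstance, inferInstance,
    fun t => RKHS.kerFun (RKHS.OfKernel K) t 1, fun s t => ?_⟩
  rw [← RKHS.kernel_inner, RKHS.OfKernel.kernel_ofKernel]
  simp [K, hsymm t s]

/-- Combines `|exp (ia) - exp (ib)| ≤ |a - b|` with `L¹ ≤ L²` on a probability space. It lets the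
Gaussian formula pass from a dense subspace to the whole Hilbert space. -/
lemma lipschitz_charFun_Lp {Ω : Type*} [MeasurableSpace Ω] (P : Measure Ω)
    [IsProbabilityMeasure P] :
    LipschitzWith 1 fun f : Lp ℝ 2 P => ∫ ω, Complex.exp (f ω * Complex.I) ∂P := by
  have hint : ∀ f : Lp ℝ 2 P, Integrable (fun ω => Complex.exp (f ω * Complex.I)) P := fun f =>
    Integrable.of_bound (by
      have := Lp.aestronglyMeasurable f
      fun_prop) 1 (ae_of_all _ fun ω => (Complex.norm_exp_ofReal_mul_I _).le)
  refine LipschitzWith.of_dist_le_mul fun f g => ?_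
  have hfg : Integrable (fun ω => ‖(f - g) ω‖) P :=
    ((Lp.memLp (f - g)).integrable (by norm_num)).norm
  have hpt : ∀ a b : ℝ, ‖Complex.exp (a * Complex.I) - Complex.exp (b * Complex.I)‖ ≤ ‖a - b‖ := by
    intro a b
    have h : Complex.exp (a * Complex.I) - Complex.exp (b * Complex.I) =
        Complex.exp (b * Complex.I) * (Complex.exp (Complex.I * (a - b : ℝ)) - 1) := by
      rw [mul_sub, ← Complex.exp_add]
      congr 2 <;> push_cast <;> ring_nf
    rw [h, norm_mul, Complex.norm_exp_ofReal_mul_I, one_mul]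
    exact Real.norm_exp_I_mul_ofReal_sub_one_le
  rw [dist_eq_norm, dist_eq_norm, ← integral_sub (hint f) (hint g)]
  calc _ ≤ ∫ ω, ‖Complex.exp (f ω * Complex.I) - Complex.exp (g ω * Complex.I)‖ ∂P :=
        norm_integral_le_integral_norm _
    _ ≤ ∫ ω, ‖(f - g) ω‖ ∂P := by
        refine integral_mono_ae ((hint f).sub (hint g)).norm hfg ?_
        filter_upwards [Lp.coeFn_sub f g] with ω hω
        rw [hω]
        exact hpt _ _
    _ = (eLpNorm (f - g : Lp ℝ 2 P) 1 P).toReal := by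
        rw [eLpNorm_one_eq_lintegral_enorm, integral_norm_eq_lintegral_enorm
          (Lp.aestronglyMeasurable _)]
    _ ≤ (eLpNorm (f - g : Lp ℝ 2 P) 2 P).toReal :=
        ENNReal.toReal_mono (Lp.eLpNorm_ne_top _) (eLpNorm_le_eLpNorm_of_exponent_le (by norm_num)
          (Lp.aestronglyMeasurable _))
    _ = _ := by rw [NNReal.coe_one, one_mul, Lp.norm_def]

/-- Every real Hilbert space embeds isometrically into the space of centred Gaussian variables of
some probability space. -/
theorem exists_isonormal (H : Type) [NormedAddCommGroup H] [InnerProductSpace ℝ H]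
    [CompleteSpace H] :
    ∃ (Ω : Type) (_ : MeasurableSpace Ω) (P : Measure Ω) (_ : IsProbabilityMeasure P)
      (Φ : H →ₗᵢ[ℝ] Lp ℝ 2 P), ∀ h, P.map (Φ h) = gaussianReal 0 (‖h‖ ^ 2).toNNReal := by
  obtain ⟨ι, b, -⟩ := exists_hilbertBasis ℝ H
  -- Independent standard Gaussian coordinates, one per vector of a Hilbert basis, form an
  -- orthonormal family in `L²`; `Φ` sends the basis to it.
  let P : Measure (ι → ℝ) := Measure.infinitePi fun _ => gaussianReal 0 1
  have hlaw : ∀ i, HasLaw (fun ω : ι → ℝ => ω i) (gaussianReal 0 1) P := fun i =>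
    ⟨(measurable_pi_apply i).aemeasurable,
      (measurePreserving_eval_infinitePi (fun _ : ι => gaussianReal 0 1) i).map_eq⟩
  have hind : iIndepFun (fun (i : ι) (ω : ι → ℝ) => ω i) P :=
    iIndepFun_infinitePi (X := fun _ x => x) fun _ => measurable_id
  have hmul : ∀ (a : ℝ) (i : ι), Measurable fun ω : ι → ℝ => a * ω i := fun a i => by fun_prop
  have hmem : ∀ i, MemLp (fun ω : ι → ℝ => ω i) 2 P := fun i =>
    (hlaw i).hasGaussianLaw.memLp_two
  have hmean : ∀ i, ∫ ω, ω i ∂P = 0 := fun i => by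
    rw [(hlaw i).integral_eq, integral_id_gaussianReal]
  let ξ : ι → Lp ℝ 2 P := fun i => (hmem i).toLp
  have hinner : ∀ i j, ⟪ξ i, ξ j⟫ = ∫ ω, ω i * ω j ∂P := by
    intro i j
    rw [L2.inner_def]
    refine integral_congr_ae ?_
    filter_upwards [(hmem i).coeFn_toLp, (hmem j).coeFn_toLp] with ω hi hj
    simp [ξ, hi, hj, mul_comm]
  have hξ : Orthonormal ℝ ξ := by
    classical
    rw [orthonormal_iff_ite]
    intro i j
    rw [hinner]
    split_ifs with hij
    · subst hij
      have h1 := (hlaw i).variance_eq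
      rw [variance_eq_integral (hlaw i).aemeasurable, hmean, variance_id_gaussianReal] at h1
      simpa [sq] using h1
    · rw [(hind.indepFun hij).integral_fun_mul_eq_mul_integral
        (hmem i).aestronglyMeasurable (hmem j).aestronglyMeasurable, hmean, zero_mul]
  let Φ : H →ₗᵢ[ℝ] Lp ℝ 2 P :=
    hξ.orthogonalFamily.linearIsometry.comp b.repr.toLinearIsometry
  have hΦ : ∀ i, Φ (b i) = ξ i := by
    classical
    intro i
    simp [Φ, b.repr_self, OrthogonalFamily.linearIsometry_apply_single]
  have hchar : ∀ h : H, ∫ ω, Complex.exp (Φ h ω * Complex.I) ∂P =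
      Complex.exp (-(‖h‖ ^ 2 : ℝ) / 2) := by
    -- Both sides are continuous in `h`, so the identity needs checking only on finite combinations
    -- of basis vectors, where independence factors the characteristic function.
    have hclosed : IsClosed {h : H | ∫ ω, Complex.exp (Φ h ω * Complex.I) ∂P =
        Complex.exp (-(‖h‖ ^ 2 : ℝ) / 2)} :=
      isClosed_eq ((lipschitz_charFun_Lp P).continuous.comp Φ.continuous) (by fun_prop)
    have hspan : ∀ h ∈ Submodule.span ℝ (Set.range b),
        ∫ ω, Complex.exp (Φ h ω * Complex.I) ∂P = Complex.exp (-(‖h‖ ^ 2 : ℝ) / 2) := by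
      intro h hh
      obtain ⟨c, rfl⟩ := Finsupp.mem_span_range_iff_exists_finsupp.1 hh
      have h1 : Φ (c.sum fun i a => a • b i) =ᵐ[P] fun ω => ∑ i ∈ c.support, c i * ω i := by
        rw [Finsupp.sum, map_sum]
        refine (Lp.coeFn_fun_finsetSum _ _).trans ?_
        have : ∀ i ∈ c.support, Φ (c i • b i) =ᵐ[P] fun ω => c i * ω i := by
          intro i _
          rw [map_smul, hΦ]
          filter_upwards [Lp.coeFn_smul (c i) (ξ i), (hmem i).coeFn_toLp] with ω h1 h2
          rw [h1, Pi.smul_apply, smul_eq_mul, h2]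
        filter_upwards [(ae_ball_iff c.support.countable_toSet).2 this] with ω hω
        exact Finset.sum_congr rfl hω
      have h2 : ∫ ω, Complex.exp (Φ (c.sum fun i a => a • b i) ω * Complex.I) ∂P =
          charFun (P.map fun ω => ∑ i ∈ c.support, c i * ω i) 1 := by
        rw [charFun_apply_real, integral_map (Finset.measurable_fun_sum _ fun i _ =>
          hmul (c i) i).aemeasurable (by fun_prop)]
        refine integral_congr_ae ?_
        filter_upwards [h1] with ω hω
        rw [hω]
        simp
      have hind2 : iIndepFun (c.support.restrict fun i (ω : ι → ℝ) => c i * ω i) P :=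
        (hind.comp (fun i x => c i * x) fun i => by fun_prop).precomp
          (g := fun i : c.support => (i : ι)) Subtype.val_injective
      have hnorm : ‖c.sum fun i a => a • b i‖ ^ 2 = ∑ i ∈ c.support, c i ^ 2 := by
        rw [← real_inner_self_eq_norm_sq, Finsupp.sum, b.orthonormal.inner_sum]
        simp [sq]
      rw [h2, iIndepFun.charFun_map_fun_finsetSum_eq_prod
          (fun i _ => (hmul (c i) i).aemeasurable) hind2,
        Finset.prod_apply, hnorm, Complex.ofReal_sum, ← Finset.sum_neg_distrib,
        Finset.sum_div, Complex.exp_sum]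
      refine Finset.prod_congr rfl fun i _ => ?_
      rw [charFun_map_mul_comp (measurable_pi_apply i).aemeasurable, (hlaw i).map_eq,
        charFun_gaussianReal]
      simp [neg_div]
    intro h
    have hd : Dense (Submodule.span ℝ (Set.range b) : Set H) :=
      Submodule.dense_iff_topologicalClosure_eq_top.2 b.dense_span
    exact (hclosed.closure_subset_iff.2 hspan) (hd h)
  refine ⟨ι → ℝ, inferInstance, P, inferInstance, Φ, fun h => ?_⟩
  have hm : AEMeasurable (Φ h) P := (Lp.aestronglyMeasurable _).aemeasurable
  have := Measure.isProbabilityMeasure_map hm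
  refine Measure.ext_of_charFun ?_
  ext t
  rw [charFun_gaussianReal, charFun_apply_real, integral_map hm (by fun_prop)]
  have h1 : ∫ ω, Complex.exp (t * Φ h ω * Complex.I) ∂P =
      ∫ ω, Complex.exp (Φ (t • h) ω * Complex.I) ∂P := by
    refine integral_congr_ae ?_
    rw [map_smul]
    filter_upwards [Lp.coeFn_smul t (Φ h)] with ω hω
    rw [hω]
    simp
  rw [h1, hchar, norm_smul, Real.coe_toNNReal _ (by positivity)]
  congr 1
  rw [mul_pow, Real.norm_eq_abs, sq_abs]
  push_cast
  ring

/-- A positive semidefinite kernel is the covariance of a centred Gaussian process. -/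
theorem exists_isGaussianProcess {T : Type} (k : T → T → ℝ) (hsymm : ∀ s t, k s t = k t s)
    (hpos : ∀ c : T →₀ ℝ, 0 ≤ c.sum fun s a => c.sum fun t b => a * b * k s t) :
    ∃ (Ω : Type) (_ : MeasurableSpace Ω) (P : Measure Ω) (_ : IsProbabilityMeasure P)
      (X : T → Ω → ℝ), IsGaussianProcess X P ∧ (∀ t, ∫ ω, X t ω ∂P = 0) ∧
        ∀ s t, ∫ ω, X s ω * X t ω ∂P = k s t := by
  classical
  obtain ⟨H, _, _, _, h, hh⟩ := exists_gram_of_posSemidef k hsymm hpos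
  obtain ⟨Ω, mΩ, P, hP, Φ, hΦ⟩ := exists_isonormal H
  have hm : ∀ x, AEMeasurable (Φ x) P := fun x => (Lp.aestronglyMeasurable _).aemeasurable
  refine ⟨Ω, mΩ, P, hP, fun t => Φ (h t), ⟨fun I => ⟨?_⟩⟩, fun t => ?_, fun s t => ?_⟩
  -- A linear functional of the vector is again in the range of `Φ`: it equals `Φ (∑ L(eᵢ) hᵢ)`,
  -- whose law is Gaussian.
  · refine isGaussian_of_map_eq_gaussianReal fun L => ?_
    refine ⟨0, (‖∑ i : I, L (Pi.single i 1) • h i‖ ^ 2).toNNReal, ?_⟩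
    have hm2 : AEMeasurable (fun ω => I.restrict fun t => Φ (h t) ω) P :=
      aemeasurable_pi_lambda _ fun i => hm _
    rw [← hΦ, AEMeasurable.map_map_of_aemeasurable (by fun_prop) hm2]
    refine Measure.map_congr ?_
    rw [map_sum]
    refine EventuallyEq.trans ?_ (Lp.coeFn_fun_finsetSum _ _).symm
    have : ∀ i : I, Φ (L (Pi.single i 1) • h i) =ᵐ[P] fun ω => L (Pi.single i 1) * Φ (h i) ω := by
      intro i
      rw [map_smul]
      exact Lp.coeFn_smul _ _
    filter_upwards [ae_all_iff.2 this] with ω hω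
    rw [Finset.sum_congr rfl fun i _ => hω i, Function.comp_apply]
    conv_lhs => rw [← Finset.univ_sum_single (I.restrict fun t => Φ (h t) ω), map_sum]
    refine Finset.sum_congr rfl fun i _ => ?_
    have : Pi.single i (I.restrict (fun t => Φ (h t) ω) i) =
        (Φ (h i) ω) • (Pi.single i 1 : I → ℝ) := by
      rw [← Pi.single_smul]
      simp
    rw [this, map_smul, smul_eq_mul, mul_comm]
  · have := integral_map (hm (h t)) (f := fun x : ℝ => x) (by fun_prop)
    rw [← this, hΦ, integral_id_gaussianReal]
  · rw [← hh, ← Φ.inner_map_map, L2.inner_def]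
    simp [mul_comm]

/-! ### The covariogram of a convex body near the origin -/

/-- Points of a compact interval that leave it under a shift by `t > 0`. -/
lemma volume_setOf_add_notMem_le {S : Set ℝ} (hS : Convex ℝ S) (hc : IsCompact S) {t : ℝ}
    (ht : 0 < t) : volume {s | s ∈ S ∧ s + t ∉ S} ≤ ENNReal.ofReal t := by
  rcases S.eq_empty_or_nonempty with rfl | hne
  · simp
  rw [eq_Icc_of_connected_compact ⟨hne, hS.isPreconnected⟩ hc]
  calc volume {s | s ∈ Icc (sInf S) (sSup S) ∧ s + t ∉ Icc (sInf S) (sSup S)}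
      ≤ volume (Ioc (sSup S - t) (sSup S)) := by
        refine measure_mono fun s hs => ?_
        simp only [mem_ofPred_eq, mem_Icc, not_and, not_le, mem_Ioc] at hs ⊢
        exact ⟨by linarith [hs.2 (by linarith [hs.1.1])], hs.1.2⟩
    _ = _ := by rw [Real.volume_Ioc]; congr 1; ring

/-- Equality holds as soon as `t` is less than the length of the interval. A one-point interval, for
which it fails, is excluded by the interior. -/
lemma eventually_volume_setOf_add_notMem {S : Set ℝ} (hS : Convex ℝ S) (hc : IsCompact S)
    (hint : (interior S).Nonempty) :
    ∀ᶠ t in nhdsWithin (0 : ℝ) (Ioi 0),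
      volume {s | s ∈ S ∧ s + t ∉ S} = ENNReal.ofReal t := by
  have hne := hint.mono interior_subset
  obtain ⟨a, b, rfl⟩ : ∃ a b, S = Icc a b :=
    ⟨_, _, eq_Icc_of_connected_compact ⟨hne, hS.isPreconnected⟩ hc⟩
  have hlt : a < b := by
    rw [interior_Icc] at hint
    exact nonempty_Ioo.1 hint
  filter_upwards [Ioo_mem_nhdsGT (sub_pos.2 hlt)] with t ht
  have : {s | s ∈ Icc a b ∧ s + t ∉ Icc a b} = Ioc (b - t) b := by
    ext s
    simp only [mem_ofPred_eq, mem_Icc, not_and, not_le, mem_Ioc]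
    exact ⟨fun h => ⟨by linarith [h.2 (by linarith [h.1.1, ht.1])], h.1.2⟩,
      fun h => ⟨⟨by linarith [h.1, ht.2], h.2⟩, fun _ => by linarith [h.1]⟩⟩
  rw [this, Real.volume_Ioc]
  congr 1
  ring

/-- Orthogonal coordinates `(y, t) ↦ y + t u` on `ℝᵈ`, for a unit vector `u`. -/
noncomputable def hyperplaneCoordinates {d : ℕ} (u : Rd d) (hu : ‖u‖ = 1) :
    ((ℝ ∙ u)ᗮ × ℝ) ≃ₗ[ℝ] Rd d where
  toFun q := (q.1 : Rd d) + q.2 • u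
  map_add' q q' := by simp only [Prod.fst_add, Prod.snd_add, Submodule.coe_add, add_smul]; abel
  map_smul' c q := by simp [smul_smul]
  invFun x := ((ℝ ∙ u)ᗮ.orthogonalProjectionOnto x, ⟪u, x⟫)
  left_inv q := by
    have h1 : ⟪u, (q.1 : Rd d)⟫ = 0 := Submodule.mem_orthogonal_singleton_iff_inner_right.1 q.1.2
    ext1
    · simp
    · simp [inner_add_right, h1, real_inner_smul_right, hu]
  right_inv x := by
    simp only [Submodule.coe_orthogonalProjectionOnto_apply]
    rw [← Submodule.starProjection_unit_singleton ℝ hu x,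
      Submodule.starProjection_orthogonal_val]
    abel

/-- An orthonormal basis of `u^⊥` completed by `u` is an orthonormal basis of the whole space, and
Lebesgue measure is the Haar measure normalised by any such basis. -/
lemma measurePreserving_hyperplaneCoordinates {d : ℕ} (u : Rd d) (hu : ‖u‖ = 1) :
    MeasurePreserving (hyperplaneCoordinates u hu)
      ((hyperplaneVolume u).prod (volume : Measure ℝ)) volume := by
  let T := (hyperplaneCoordinates u hu).toContinuousLinearEquiv
  let b := stdOrthonormalBasis ℝ ((ℝ ∙ u)ᗮ : Submodule ℝ (Rd d))
  let s : OrthonormalBasis Unit ℝ ℝ := OrthonormalBasis.singleton Unit ℝ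
  refine ⟨T.continuous.measurable, ?_⟩
  have h1 : (volume : Measure ℝ) = s.toBasis.addHaar := s.addHaar_eq_volume.symm
  have h2 : Orthonormal ℝ ((b.toBasis.prod s.toBasis).map T.toLinearEquiv) := by
    have hT : ∀ q, T.toLinearEquiv q = (q.1 : Rd d) + q.2 • u := fun q => rfl
    have hu0 : ∀ y : ((ℝ ∙ u)ᗮ : Submodule ℝ (Rd d)), ⟪u, (y : Rd d)⟫ = 0 := fun y =>
      Submodule.mem_orthogonal_singleton_iff_inner_right.1 y.2
    have hb := orthonormal_iff_ite.1 b.orthonormal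
    rw [orthonormal_iff_ite]
    rintro (i | i) (j | j)
    · simpa [hT] using hb i j
    · simp [hT, s, real_inner_comm u, hu0]
    · simp [hT, s, hu0]
    · simp [hT, s, hu]
  rw [hyperplaneVolume, h1, ← Module.Basis.prod_addHaar]
  change Measure.map T _ = _
  rw [Module.Basis.map_addHaar, ← (Module.Basis.toOrthonormalBasis _ h2).addHaar_eq_volume,
    Module.Basis.toBasis_toOrthonormalBasis]

/-- The volume of the set of points of `K` that leave `K` under translation by `z`. -/
noncomputable def shiftDefect {d : ℕ} (K : Set (Rd d)) (z : Rd d) : ℝ≥0∞ :=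
  volume {x | x ∈ K ∧ x + z ∉ K}

/-! ### Volume lost under translation: derivative at the origin, symmetry, subadditivity. -/

section ShiftDefect

variable {d : ℕ} {K : Set (Rd d)}

instance isAddHaarMeasure_hyperplaneVolume (u : Rd d) :
    (hyperplaneVolume u).IsAddHaarMeasure := by
  unfold hyperplaneVolume
  infer_instance

instance sigmaFinite_hyperplaneVolume (u : Rd d) : SigmaFinite (hyperplaneVolume u) := by
  unfold hyperplaneVolume
  infer_instance

lemma measurableSet_shiftDefect (hK : IsCompact K) (z : Rd d) :
    MeasurableSet {x | x ∈ K ∧ x + z ∉ K} :=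
  hK.measurableSet.inter ((measurable_add_const z) hK.measurableSet).compl

/-- The part of `K` on the line through `y` in direction `u`. -/
def lineSection (K : Set (Rd d)) (u : Rd d) (y : ((ℝ ∙ u)ᗮ : Submodule ℝ (Rd d))) : Set ℝ :=
  {s | (y : Rd d) + s • u ∈ K}

/-- Fubini along the lines parallel to `u`. -/
lemma shiftDefect_smul_eq_lintegral (hK : IsCompact K) {u : Rd d} (hu : ‖u‖ = 1) (t : ℝ) :
    shiftDefect K (t • u) = ∫⁻ y, volume {s | s ∈ lineSection K u y ∧ s + t ∉ lineSection K u y}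
      ∂(hyperplaneVolume u) := by
  have hA := measurableSet_shiftDefect hK (t • u)
  have hT := measurePreserving_hyperplaneCoordinates u hu
  rw [shiftDefect, ← hT.measure_preimage hA.nullMeasurableSet,
    Measure.prod_apply (hT.measurable hA)]
  refine lintegral_congr fun y => ?_
  congr 1
  ext s
  simp [hyperplaneCoordinates, lineSection, add_smul, add_assoc]

lemma convex_lineSection (hc : Convex ℝ K) (u : Rd d) (y) : Convex ℝ (lineSection K u y) := by
  intro s hs t ht a b ha hb hab
  have := hc hs ht ha hb hab
  simp only [lineSection, mem_ofPred_eq] at this ⊢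
  convert this using 1
  rw [smul_add, smul_add, add_add_add_comm, ← add_smul, hab, one_smul, smul_smul, smul_smul,
    ← add_smul]
  rfl

lemma isCompact_lineSection (hK : IsCompact K) {u : Rd d} (hu : ‖u‖ = 1) (y) :
    IsCompact (lineSection K u y) := by
  have : Isometry fun s : ℝ => (y : Rd d) + s • u := by
    refine Isometry.of_dist_eq fun s t => ?_
    rw [dist_add_left, dist_eq_norm, ← sub_smul, norm_smul, hu, mul_one, Real.dist_eq,
      Real.norm_eq_abs]
  exact this.isClosedEmbedding.isCompact_preimage hK

lemma eq_orthogonalProjection_add {u : Rd d} (hu : ‖u‖ = 1) (x : Rd d) :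
    ((ℝ ∙ u)ᗮ.orthogonalProjectionOnto x : Rd d) + ⟪u, x⟫ • u = x :=
  (hyperplaneCoordinates u hu).right_inv x

lemma orthogonalProjection_add_smul {u : Rd d} (hu : ‖u‖ = 1)
    (y : ((ℝ ∙ u)ᗮ : Submodule ℝ (Rd d))) (s : ℝ) :
    (ℝ ∙ u)ᗮ.orthogonalProjectionOnto ((y : Rd d) + s • u) = y :=
  congrArg Prod.fst ((hyperplaneCoordinates u hu).left_inv (y, s))

lemma nonempty_lineSection_iff {u : Rd d} (hu : ‖u‖ = 1) (y) :
    (lineSection K u y).Nonempty ↔ y ∈ (ℝ ∙ u)ᗮ.orthogonalProjectionOnto '' K := by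
  constructor
  · rintro ⟨s, hs⟩
    exact ⟨_, hs, orthogonalProjection_add_smul hu y s⟩
  · rintro ⟨x, hx, rfl⟩
    exact ⟨⟪u, x⟫, by rwa [lineSection, mem_ofPred_eq, eq_orthogonalProjection_add hu]⟩

lemma isCompact_orthogonalProjection_image (hK : IsCompact K) (u : Rd d) :
    IsCompact ((ℝ ∙ u)ᗮ.orthogonalProjectionOnto '' K) :=
  hK.image (ContinuousLinearMap.continuous _)

lemma volume_lineSection_le (hc : Convex ℝ K) (hK : IsCompact K) {u : Rd d} (hu : ‖u‖ = 1)
    {t : ℝ} (ht : 0 < t) (y) :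
    volume {s | s ∈ lineSection K u y ∧ s + t ∉ lineSection K u y} ≤
      ((ℝ ∙ u)ᗮ.orthogonalProjectionOnto '' K).indicator (fun _ => ENNReal.ofReal t) y := by
  by_cases hy : y ∈ (ℝ ∙ u)ᗮ.orthogonalProjectionOnto '' K
  · rw [indicator_of_mem hy]
    exact volume_setOf_add_notMem_le (convex_lineSection hc u y) (isCompact_lineSection hK hu y) ht
  · rw [indicator_of_notMem hy]
    rw [← nonempty_lineSection_iff hu, not_nonempty_iff_eq_empty] at hy
    simp [hy]

lemma shiftDefect_smul_le (hc : Convex ℝ K) (hK : IsCompact K) {u : Rd d} (hu : ‖u‖ = 1)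
    {t : ℝ} (ht : 0 < t) :
    shiftDefect K (t • u) ≤ ENNReal.ofReal t *
      hyperplaneVolume u ((ℝ ∙ u)ᗮ.orthogonalProjectionOnto '' K) := by
  rw [shiftDefect_smul_eq_lintegral hK hu,
    ← lintegral_indicator_const (isCompact_orthogonalProjection_image hK u).measurableSet]
  exact lintegral_mono fun y => volume_lineSection_le hc hK hu ht y

/-- The projection of the boundary of a convex body is negligible. -/
lemma hyperplaneVolume_diff_eq_zero (hc : Convex ℝ K) (hint : (interior K).Nonempty) (u : Rd d) :
    hyperplaneVolume u ((ℝ ∙ u)ᗮ.orthogonalProjectionOnto '' K \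
      (ℝ ∙ u)ᗮ.orthogonalProjectionOnto '' interior K) = 0 := by
  set π := (ℝ ∙ u)ᗮ.orthogonalProjectionOnto
  have hconv : Convex ℝ (π '' interior K) := hc.interior.linear_image π.toLinearMap
  have hsurj : Function.Surjective π := fun y =>
    ⟨y, Submodule.orthogonalProjectionOnto_mem_subspace_eq_self y⟩
  have hopen : IsOpen (π '' interior K) := π.isOpenMap hsurj _ isOpen_interior
  -- The image of `K` lies in the closure of the open convex image of its interior, and the frontier
  -- of a convex set is null.
  refine measure_mono_null ?_ (hconv.addHaar_frontier (hyperplaneVolume u))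
  rw [frontier, hopen.interior_eq]
  refine sdiff_subset_sdiff_left ?_
  calc π '' K ⊆ π '' closure (interior K) := by
        rw [hc.closure_interior_eq_closure_of_nonempty_interior hint]
        exact image_mono subset_closure
    _ ⊆ _ := image_closure_subset_closure_image π.continuous

/-- Matheron's formula. After division by `t`, almost every line meeting `K` contributes exactly `1`
once `t` is small, and never more than `1`; dominated convergence then counts these lines by the
volume of the projection. -/
lemma tendsto_shiftDefect_smul (hc : Convex ℝ K) (hK : IsCompact K)
    (hint : (interior K).Nonempty) {u : Rd d} (hu : ‖u‖ = 1) :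
    Tendsto (fun t : ℝ => ENNReal.ofReal t⁻¹ * shiftDefect K (t • u)) (nhdsWithin 0 (Ioi 0))
      (nhds (hyperplaneVolume u ((ℝ ∙ u)ᗮ.orthogonalProjectionOnto '' K))) := by
  set A := (ℝ ∙ u)ᗮ.orthogonalProjectionOnto '' K with hA
  have hAc : IsCompact A := isCompact_orthogonalProjection_image hK u
  have hcancel : ∀ t : ℝ, 0 < t → ENNReal.ofReal t⁻¹ * ENNReal.ofReal t = 1 := fun t ht => by
    rw [← ENNReal.ofReal_mul (by positivity), inv_mul_cancel₀ ht.ne', ENNReal.ofReal_one]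
  have hmeas : ∀ t : ℝ, Measurable fun y =>
      volume {s | s ∈ lineSection K u y ∧ s + t ∉ lineSection K u y} := by
    intro t
    have h := measurable_measure_prodMk_left (ν := (volume : Measure ℝ))
      ((measurePreserving_hyperplaneCoordinates u hu).measurable
        (measurableSet_shiftDefect hK (t • u)))
    convert h using 3 with y
    ext s
    simp [hyperplaneCoordinates, lineSection, add_smul, add_assoc]
  have hlim : Tendsto (fun t : ℝ => ∫⁻ y, ENNReal.ofReal t⁻¹ *
      volume {s | s ∈ lineSection K u y ∧ s + t ∉ lineSection K u y} ∂(hyperplaneVolume u))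
      (nhdsWithin 0 (Ioi 0)) (nhds (∫⁻ y, A.indicator 1 y ∂(hyperplaneVolume u))) := by
    refine tendsto_lintegral_filter_of_dominated_convergence (A.indicator 1)
      (Eventually.of_forall fun t => (hmeas t).const_mul _) ?_ ?_ ?_
    · filter_upwards [self_mem_nhdsWithin] with t ht
      refine ae_of_all _ fun y => ?_
      refine (mul_le_mul_right (volume_lineSection_le hc hK hu ht y) _).trans ?_
      by_cases hy : y ∈ A
      · simp [← hA, hy, hcancel t ht]
      · simp [← hA, hy]
    · rw [lintegral_indicator_one hAc.measurableSet]
      exact hAc.measure_lt_top.ne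
    -- Lines that touch `K` but miss its interior may meet it in a single point; they are
    -- negligible.
    · have hae : ∀ᵐ y ∂(hyperplaneVolume u),
          y ∉ A \ (ℝ ∙ u)ᗮ.orthogonalProjectionOnto '' interior K :=
        measure_eq_zero_iff_ae_notMem.1 (hyperplaneVolume_diff_eq_zero hc hint u)
      filter_upwards [hae] with y hy
      by_cases hyA : y ∈ A
      · have hy2 : y ∈ (ℝ ∙ u)ᗮ.orthogonalProjectionOnto '' interior K := by
          by_contra h
          exact hy ⟨hyA, h⟩
        have hsec : (interior (lineSection K u y)).Nonempty := by
          refine ((nonempty_lineSection_iff hu y).2 hy2).mono (interior_maximal ?_ ?_)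
          · exact fun s hs => interior_subset (s := K) hs
          · exact isOpen_interior.preimage
              (f := fun s : ℝ => (y : Rd d) + s • u) (by fun_prop)
        refine tendsto_const_nhds.congr' ?_
        filter_upwards [eventually_volume_setOf_add_notMem (convex_lineSection hc u y)
          (isCompact_lineSection hK hu y) hsec, self_mem_nhdsWithin] with t ht ht0
        rw [ht, hcancel t ht0]
        simp [hyA]
      · refine tendsto_const_nhds.congr' ?_
        filter_upwards [self_mem_nhdsWithin] with t ht0
        have := volume_lineSection_le hc hK hu ht0 y
        rw [indicator_of_notMem hyA, nonpos_iff_eq_zero] at this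
        rw [this]
        simp [hyA]
  rw [lintegral_indicator_one hAc.measurableSet] at hlim
  refine hlim.congr fun t => ?_
  rw [shiftDefect_smul_eq_lintegral hK hu, lintegral_const_mul _ (hmeas t)]

lemma shiftDefect_zero : shiftDefect K 0 = 0 := by
  simp [shiftDefect]

lemma shiftDefect_lt_top (hK : IsCompact K) (z : Rd d) : shiftDefect K z < ∞ :=
  (measure_mono fun _ hx => hx.1).trans_lt hK.measure_lt_top

/-- The defect is `|K| - |K ∩ (K - z)|`, and `K ∩ (K - z)` is a translate of `K ∩ (K + z)`. -/
lemma shiftDefect_neg (hK : IsCompact K) (z : Rd d) : shiftDefect K (-z) = shiftDefect K z := by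
  have h : ∀ z : Rd d, shiftDefect K z = volume K - volume {x | x ∈ K ∧ x + z ∈ K} := by
    intro z
    have hm : MeasurableSet {x | x ∈ K ∧ x + z ∈ K} :=
      hK.measurableSet.inter ((measurable_add_const z) hK.measurableSet)
    rw [← measure_sdiff (fun _ hx => hx.1) hm.nullMeasurableSet
      ((measure_mono fun _ hx => hx.1).trans_lt hK.measure_lt_top).ne, shiftDefect]
    congr 1
    ext x
    simp
  rw [h, h, ← measure_preimage_add_right volume z {x | x ∈ K ∧ x + -z ∈ K}]
  congr 2
  ext x
  simp [and_comm]

/-- A point that leaves `K` under `z + w` either leaves under `z`, or stays and then leaves under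
`w`. -/
lemma shiftDefect_add_le (z w : Rd d) :
    shiftDefect K (z + w) ≤ shiftDefect K z + shiftDefect K w := by
  calc shiftDefect K (z + w)
      ≤ volume ({x | x ∈ K ∧ x + z ∉ K} ∪ (fun x => x + z) ⁻¹' {x | x ∈ K ∧ x + w ∉ K}) := by
        refine measure_mono fun x hx => ?_
        by_cases h : x + z ∈ K
        · exact Or.inr ⟨h, by rw [add_assoc]; exact hx.2⟩
        · exact Or.inl ⟨hx.1, h⟩
    _ ≤ _ := (measure_union_le _ _).trans_eq (by rw [measure_preimage_add_right]; rfl)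

end ShiftDefect

/-! ### The projection norm and the polar projection body as its unit ball. -/

section ProjectionNorm

variable {d : ℕ} {K : Set (Rd d)}

/-- The positively homogeneous extension of the projection volume from the unit sphere. -/
noncomputable def projectionNorm (K : Set (Rd d)) (z : Rd d) : ℝ :=
  ‖z‖ * projectionVolume K (‖z‖⁻¹ • z)

lemma projectionNorm_of_norm_eq_one {u : Rd d} (hu : ‖u‖ = 1) :
    projectionNorm K u = projectionVolume K u := by
  simp [projectionNorm, hu]

lemma projectionNorm_nonneg (z : Rd d) : 0 ≤ projectionNorm K z :=
  mul_nonneg (norm_nonneg _) ENNReal.toReal_nonneg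

lemma projectionNorm_smul_of_pos {c : ℝ} (hc : 0 < c) (z : Rd d) :
    projectionNorm K (c • z) = c * projectionNorm K z := by
  rw [projectionNorm, projectionNorm, norm_smul, Real.norm_of_nonneg hc.le, smul_smul, mul_assoc]
  congr 4
  field_simp

lemma norm_inv_norm_smul {z : Rd d} (hz : z ≠ 0) : ‖‖z‖⁻¹ • z‖ = 1 := by
  rw [norm_smul, norm_inv, norm_norm, inv_mul_cancel₀ (norm_ne_zero_iff.2 hz)]

lemma shiftDefect_le_projectionNorm (hc : Convex ℝ K) (hK : IsCompact K) (z : Rd d) :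
    (shiftDefect K z).toReal ≤ projectionNorm K z := by
  rcases eq_or_ne z 0 with rfl | hz
  · simp [shiftDefect_zero, projectionNorm]
  have h := shiftDefect_smul_le hc hK (norm_inv_norm_smul hz) (norm_pos_iff.2 hz)
  rw [smul_inv_smul₀ (norm_ne_zero_iff.2 hz)] at h
  have h2 := ENNReal.toReal_mono (ENNReal.mul_ne_top ENNReal.ofReal_ne_top
    (isCompact_orthogonalProjection_image hK _).measure_lt_top.ne) h
  rwa [ENNReal.toReal_mul, ENNReal.toReal_ofReal (norm_nonneg _)] at h2

/-- A bound uniform in `r`, down to `r = 0`: it supplies integrability and domination in the radial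
integrals. -/
lemma mul_shiftDefect_le_projectionNorm (hc : Convex ℝ K) (hK : IsCompact K) (z : Rd d) {r : ℝ}
    (hr : 0 < r) : r * (shiftDefect K (r⁻¹ • z)).toReal ≤ projectionNorm K z := by
  have h := shiftDefect_le_projectionNorm hc hK (r⁻¹ • z)
  rw [projectionNorm_smul_of_pos (by positivity)] at h
  calc _ ≤ r * (r⁻¹ * projectionNorm K z) := by gcongr
    _ = _ := by field_simp

lemma tendsto_mul_shiftDefect (hc : Convex ℝ K) (hK : IsCompact K) (hint : (interior K).Nonempty)
    (z : Rd d) :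
    Tendsto (fun r : ℝ => r * (shiftDefect K (r⁻¹ • z)).toReal) atTop
      (nhds (projectionNorm K z)) := by
  rcases eq_or_ne z 0 with rfl | hz
  · simp [shiftDefect_zero, projectionNorm]
  have hz0 : 0 < ‖z‖ := norm_pos_iff.2 hz
  have h1 := (ENNReal.tendsto_toReal
    (isCompact_orthogonalProjection_image hK _).measure_lt_top.ne).comp
    (tendsto_shiftDefect_smul hc hK hint (norm_inv_norm_smul hz))
  -- The derivative at the origin is used with step `t = ‖z‖ / r`.
  have h2 : Tendsto (fun r : ℝ => ‖z‖ * r⁻¹) atTop (nhdsWithin 0 (Ioi 0)) := by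
    refine tendsto_nhdsWithin_iff.2 ⟨?_, ?_⟩
    · simpa using tendsto_inv_atTop_zero.const_mul ‖z‖
    · filter_upwards [eventually_gt_atTop 0] with r hr
      exact mul_pos hz0 (inv_pos.2 hr)
  refine ((h1.comp h2).const_mul ‖z‖).congr' ?_
  filter_upwards [eventually_gt_atTop 0] with r hr
  simp only [Function.comp_apply]
  rw [ENNReal.toReal_mul, ENNReal.toReal_ofReal (by positivity), smul_smul]
  have : ‖z‖ * r⁻¹ * ‖z‖⁻¹ = r⁻¹ := by field_simp
  rw [this]
  field_simp

lemma projectionNorm_neg (hc : Convex ℝ K) (hK : IsCompact K) (hint : (interior K).Nonempty)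
    (z : Rd d) : projectionNorm K (-z) = projectionNorm K z := by
  refine tendsto_nhds_unique (tendsto_mul_shiftDefect hc hK hint (-z)) ?_
  simpa only [smul_neg, shiftDefect_neg hK] using tendsto_mul_shiftDefect hc hK hint z

/-- Subadditivity is inherited in the limit from the shift defect, with no geometry of projections.
-/
lemma projectionNorm_add_le (hc : Convex ℝ K) (hK : IsCompact K) (hint : (interior K).Nonempty)
    (z w : Rd d) : projectionNorm K (z + w) ≤ projectionNorm K z + projectionNorm K w := by
  refine le_of_tendsto_of_tendsto (tendsto_mul_shiftDefect hc hK hint (z + w))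
    ((tendsto_mul_shiftDefect hc hK hint z).add (tendsto_mul_shiftDefect hc hK hint w)) ?_
  filter_upwards [eventually_gt_atTop 0] with r hr
  rw [← mul_add, ← ENNReal.toReal_add (shiftDefect_lt_top hK _).ne (shiftDefect_lt_top hK _).ne,
    smul_add]
  refine mul_le_mul_of_nonneg_left (ENNReal.toReal_mono ?_ (shiftDefect_add_le _ _)) hr.le
  exact ENNReal.add_ne_top.2 ⟨(shiftDefect_lt_top hK _).ne, (shiftDefect_lt_top hK _).ne⟩

/-- The projection norm as a seminorm. -/
noncomputable def projectionSeminorm (hc : Convex ℝ K) (hK : IsCompact K)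
    (hint : (interior K).Nonempty) : Seminorm ℝ (Rd d) :=
  Seminorm.of (projectionNorm K) (projectionNorm_add_le hc hK hint) fun a z => by
    rcases lt_trichotomy a 0 with ha | rfl | ha
    · rw [← neg_neg (a • z), projectionNorm_neg hc hK hint, ← neg_smul,
        projectionNorm_smul_of_pos (by linarith), Real.norm_of_nonpos ha.le]
    · simp [projectionNorm]
    · rw [projectionNorm_smul_of_pos ha, Real.norm_of_nonneg ha.le]

lemma projectionNorm_pos (hK : IsCompact K) (hint : (interior K).Nonempty) {z : Rd d}
    (hz : z ≠ 0) : 0 < projectionNorm K z := by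
  refine mul_pos (norm_pos_iff.2 hz) (ENNReal.toReal_pos ?_
    (isCompact_orthogonalProjection_image hK _).measure_lt_top.ne)
  set u := ‖z‖⁻¹ • z
  set π := (ℝ ∙ u)ᗮ.orthogonalProjectionOnto
  have hsurj : Function.Surjective π := fun y =>
    ⟨y, Submodule.orthogonalProjectionOnto_mem_subspace_eq_self y⟩
  have hopen : IsOpen (π '' interior K) := π.isOpenMap hsurj _ isOpen_interior
  exact ((hopen.measure_pos _ (hint.image π)).trans_le
    (measure_mono (image_mono interior_subset))).ne'

lemma continuous_projectionNorm (hc : Convex ℝ K) (hK : IsCompact K)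
    (hint : (interior K).Nonempty) : Continuous (projectionNorm K) := by
  have h : ConvexOn ℝ univ (projectionNorm K) := (projectionSeminorm hc hK hint).convexOn
  exact continuousOn_univ.1 (h.continuousOn isOpen_univ)

lemma mem_projectionBody_iff {x : Rd d} :
    x ∈ projectionBody K ↔ ∀ u, ⟪x, u⟫ ≤ projectionNorm K u := by
  refine ⟨fun h u => ?_, fun h u hu => ?_⟩
  · rcases eq_or_ne u 0 with rfl | hu
    · simp [projectionNorm]
    · have := h _ (norm_inv_norm_smul hu)
      rw [real_inner_smul_right, inv_mul_le_iff₀ (norm_pos_iff.2 hu)] at this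
      exact this
  · rw [← projectionNorm_of_norm_eq_one hu]
    exact h u

/-- The support function of the projection body is the projection norm: at every `z` there is a
point of the projection body attaining it. -/
lemma exists_mem_projectionBody_inner_eq (hc : Convex ℝ K) (hK : IsCompact K)
    (hint : (interior K).Nonempty) (z : Rd d) :
    ∃ x ∈ projectionBody K, ⟪x, z⟫ = projectionNorm K z := by
  rcases eq_or_ne z 0 with rfl | hz
  · exact ⟨0, mem_projectionBody_iff.2 fun u => by simpa using projectionNorm_nonneg u,
      by simp [projectionNorm]⟩
  -- The functional on the line through `z` with value `projectionNorm K z` at `z` is dominated by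
  -- the norm; its Hahn-Banach extension is represented by the required point.
  let f : Rd d →ₗ.[ℝ] ℝ := LinearPMap.mkSpanSingleton z (projectionNorm K z) hz
  obtain ⟨g, hg, hle⟩ := exists_extension_of_le_sublinear f (projectionNorm K)
    (fun c hc0 x => projectionNorm_smul_of_pos hc0 x) (projectionNorm_add_le hc hK hint) (by
      rintro ⟨x, hx⟩
      obtain ⟨a, rfl⟩ := Submodule.mem_span_singleton.1 hx
      change f ⟨a • z, _⟩ ≤ projectionNorm K (a • z)
      have hf : f ⟨a • z, hx⟩ = a • projectionNorm K z :=
        LinearPMap.mkSpanSingleton'_apply ..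
      rw [hf]
      have := map_smul_eq_mul (projectionSeminorm hc hK hint) a z
      change projectionNorm K (a • z) = ‖a‖ * projectionNorm K z at this
      rw [this, smul_eq_mul]
      exact mul_le_mul_of_nonneg_right (le_abs_self a) (projectionNorm_nonneg z))
  let x : Rd d := (InnerProductSpace.toDual ℝ (Rd d)).symm (LinearMap.toContinuousLinearMap g)
  have hx : ∀ u, ⟪x, u⟫ = g u := fun u => by
    simp [x]
  refine ⟨x, mem_projectionBody_iff.2 fun u => by rw [hx]; exact hle u, ?_⟩
  have hmem : z ∈ f.domain := Submodule.mem_span_singleton_self z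
  rw [hx, hg ⟨z, hmem⟩]
  exact LinearPMap.mkSpanSingleton_apply ..

/-- One inclusion uses the point of `ΠK` attaining the norm at `u`; the other is the definition of
`ΠK`. -/
theorem polarProjectionBody_eq (hc : Convex ℝ K) (hK : IsCompact K)
    (hint : (interior K).Nonempty) :
    polarProjectionBody K = {u | projectionNorm K u ≤ 1} := by
  ext u
  simp only [polarProjectionBody, polarSet, supportFunction, mem_ofPred_eq, iSup_le_iff]
  constructor
  · intro h
    obtain ⟨x, hx, hxu⟩ := exists_mem_projectionBody_inner_eq hc hK hint u
    rw [← hxu]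
    exact_mod_cast h x hx
  · intro h x hx
    exact_mod_cast (mem_projectionBody_iff.1 hx u).trans h

theorem smul_polarProjectionBody_eq (hc : Convex ℝ K) (hK : IsCompact K)
    (hint : (interior K).Nonempty) {a : ℝ} (ha : 0 < a) :
    a • polarProjectionBody K = {u | projectionNorm K u ≤ a} := by
  ext u
  rw [mem_smul_set_iff_inv_smul_mem₀ ha.ne', polarProjectionBody_eq hc hK hint, mem_ofPred_eq,
    mem_ofPred_eq, projectionNorm_smul_of_pos (inv_pos.2 ha), inv_mul_le_iff₀ ha, mul_one]

theorem gauge_smul_polarProjectionBody (hc : Convex ℝ K) (hK : IsCompact K)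
    (hint : (interior K).Nonempty) {a : ℝ} (ha : 0 < a) (z : Rd d) :
    gauge (a • polarProjectionBody K) z = projectionNorm K z / a := by
  rw [smul_polarProjectionBody_eq hc hK hint ha]
  have h : {r : ℝ | 0 < r ∧ z ∈ r • {u | projectionNorm K u ≤ a}} =
      Ioi 0 ∩ Ici (projectionNorm K z / a) := by
    ext r
    simp only [mem_ofPred_eq, mem_inter_iff, mem_Ici, mem_Ioi]
    refine and_congr_right fun hr => ?_
    rw [mem_smul_set_iff_inv_smul_mem₀ hr.ne', mem_ofPred_eq,
      projectionNorm_smul_of_pos (inv_pos.2 hr), inv_mul_le_iff₀ hr, div_le_iff₀ ha]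
  have hn : 0 ≤ projectionNorm K z / a := div_nonneg (projectionNorm_nonneg z) ha.le
  rw [gauge, h]
  -- The gauge only admits `r > 0`, so where the norm vanishes the infimum `0` is not attained.
  rcases hn.eq_or_lt with h0 | h0
  · rw [← h0, inter_eq_left.2 Ioi_subset_Ici_self, csInf_Ioi]
  · rw [inter_eq_right.2 (Ici_subset_Ioi.2 h0), csInf_Ici]

theorem isStarBody_smul_polarProjectionBody (hc : Convex ℝ K) (hK : IsCompact K)
    (hint : (interior K).Nonempty) {a : ℝ} (ha : 0 < a) :
    IsStarBody (a • polarProjectionBody K) := by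
  have hcont := continuous_projectionNorm hc hK hint
  have hset := smul_polarProjectionBody_eq hc hK hint ha
  refine ⟨⟨0, ?_⟩, ?_, ?_, ?_, ?_⟩
  · rw [hset]
    simp [projectionNorm, ha.le]
  · rw [hset]
    exact isClosed_le hcont continuous_const
  · rw [hset]
    obtain ⟨m, hm, hle⟩ : ∃ m > 0, ∀ u : Rd d, ‖u‖ = 1 → m ≤ projectionNorm K u := by
      -- The sphere is empty in dimension zero; otherwise the minimum on it is positive by
      -- compactness.
      rcases (Metric.sphere (0 : Rd d) 1).eq_empty_or_nonempty with he | hne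
      · refine ⟨1, one_pos, fun u hu => ?_⟩
        have : u ∈ Metric.sphere (0 : Rd d) 1 := by simpa using hu
        simp [he] at this
      · obtain ⟨v, hv, hmin⟩ := (isCompact_sphere (0 : Rd d) 1).exists_isMinOn hne
          hcont.continuousOn
        refine ⟨projectionNorm K v, projectionNorm_pos hK hint ?_, fun u hu =>
          hmin (by simpa using hu)⟩
        rintro rfl
        simp at hv
    refine (Metric.isBounded_closedBall (x := (0 : Rd d)) (r := a / m)).subset fun u hu => ?_
    rw [mem_closedBall_zero_iff, le_div_iff₀ hm]
    rcases eq_or_ne u 0 with rfl | hu0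
    · simpa using ha.le
    have h1 := hle _ (norm_inv_norm_smul hu0)
    rw [projectionNorm_smul_of_pos (inv_pos.2 (norm_pos_iff.2 hu0)),
      le_inv_mul_iff₀ (norm_pos_iff.2 hu0)] at h1
    exact h1.trans hu
  · intro u hu t ht0 ht1
    rw [hset] at hu ⊢
    have hopen : IsOpen {u | projectionNorm K u < a} := isOpen_lt hcont continuous_const
    have hsub : {u | projectionNorm K u < a} ⊆ {u | projectionNorm K u ≤ a} := by
      intro v hv
      rw [mem_ofPred_eq] at hv ⊢
      exact hv.le
    refine interior_maximal hsub hopen ?_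
    rw [mem_ofPred_eq]
    rcases ht0.eq_or_lt with rfl | ht
    · simpa [projectionNorm] using ha
    · rw [projectionNorm_smul_of_pos ht]
      have : projectionNorm K u ≤ a := hu
      nlinarith
  · have : gauge (a • polarProjectionBody K) = fun z => projectionNorm K z / a :=
      funext fun z => gauge_smul_polarProjectionBody hc hK hint ha z
    rw [this]
    exact hcont.div_const a

end ProjectionNorm

/-! ### Poisson intensity of the grains covering one point but not another. -/

section Intensity

variable {d : ℕ} {K : Set (Rd d)}

/-- The pairs `(x, r)` for which `x + r K` covers `z`. -/
def coverSet (K : Set (Rd d)) (z : Rd d) : Set (Rd d × ℝ) := {y | z ∈ y.1 +ᵥ y.2 • K}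

/-- The set is the projection, along the compact factor `K`, of the closed set of `(k, x, r)` with
`x + r k = z`. -/
lemma isClosed_coverSet (hK : IsCompact K) (z : Rd d) : IsClosed (coverSet K z) := by
  have := isCompact_iff_compactSpace.1 hK
  have h : IsClosed {q : K × (Rd d × ℝ) | q.2.1 + q.2.2 • (q.1 : Rd d) = z} :=
    isClosed_eq (by fun_prop) continuous_const
  convert isClosedMap_snd_of_compactSpace _ h
  ext y
  simp [coverSet, mem_vadd_set, mem_smul_set]

lemma fieldIntegrand_eq (z : Rd d) (y : Rd d × ℝ) :
    fieldIntegrand K z y =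
      (coverSet K z).indicator (fun _ => (1 : ℝ)) y -
        (coverSet K 0).indicator (fun _ => (1 : ℝ)) y :=
  rfl

/-- Change of variables `k = (z - x) / r`, with Jacobian `r ^ d`. -/
lemma volume_coverSet_diff_section (z w : Rd d) {r : ℝ} (hr : 0 < r) :
    volume {x | (x, r) ∈ coverSet K z \ coverSet K w} =
      ENNReal.ofReal (r ^ d) * shiftDefect K (r⁻¹ • (w - z)) := by
  have hmem : ∀ v x : Rd d, (x, r) ∈ coverSet K v ↔ r⁻¹ • (v - x) ∈ K := fun v x => by
    rw [coverSet, mem_ofPred_eq, mem_vadd_set_iff_neg_vadd_mem, mem_smul_set_iff_inv_smul_mem₀ hr.ne',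
      vadd_eq_add, neg_add_eq_sub]
  have h : {x | (x, r) ∈ coverSet K z \ coverSet K w} =
      (fun x => z - x) ⁻¹' ((fun x => r⁻¹ • x) ⁻¹' {k | k ∈ K ∧ k + r⁻¹ • (w - z) ∉ K}) := by
    ext x
    simp only [mem_ofPred_eq, Set.mem_sdiff, hmem, mem_preimage, ← smul_add]
    rw [show z - x + (w - z) = w - x by abel]
  have he : MeasurableEmbedding fun x : Rd d => z - x :=
    (Homeomorph.subLeft z).measurableEmbedding
  rw [h, (Measure.measurePreserving_sub_left volume z).measure_preimage_emb he,
    Measure.addHaar_preimage_smul _ (inv_ne_zero hr.ne'), shiftDefect]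
  congr 2
  rw [finrank_euclideanSpace_fin, inv_pow, inv_inv, abs_of_pos (by positivity)]

lemma measurable_shiftDefect (hK : IsCompact K) : Measurable (shiftDefect K) := by
  have hm : MeasurableSet {q : Rd d × Rd d | q.2 ∈ K ∧ q.2 + q.1 ∉ K} :=
    (measurable_snd hK.measurableSet).inter
      ((measurable_snd.add measurable_fst) hK.measurableSet).compl
  exact measurable_measure_prodMk_left hm

/-- The condition `p > 1/2` is what makes `r ^ (2p - 2)` integrable at `0`; the other factor is
bounded. -/
lemma intervalIntegrable_radial (hc : Convex ℝ K) (hK : IsCompact K) {p : ℝ} (hp : 1 / 2 < p)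
    (v : Rd d) (C : ℝ) (hC : 0 ≤ C) :
    IntervalIntegrable (fun r => r ^ (2 * p - 2) * (r * (shiftDefect K (r⁻¹ • v)).toReal))
      volume 0 C := by
  have h1 : IntervalIntegrable (fun r : ℝ => r ^ (2 * p - 2)) volume 0 C :=
    intervalIntegral.intervalIntegrable_rpow' (by linarith)
  rw [intervalIntegrable_iff_integrableOn_Ioc_of_le hC] at h1 ⊢
  refine h1.mul_bdd (c := projectionNorm K v) ?_ ?_
  · have := (measurable_shiftDefect hK).ennreal_toReal
    exact (measurable_id.mul (this.comp (measurable_inv.smul_const v))).aestronglyMeasurable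
  · refine (ae_restrict_iff' measurableSet_Ioc).2 (ae_of_all _ fun r hr => ?_)
    rw [Real.norm_of_nonneg (mul_nonneg hr.1.le ENNReal.toReal_nonneg)]
    exact mul_shiftDefect_le_projectionNorm hc hK v hr.1

/-- Fubini in `r`: the density `r ^ (-d-1+2p)` times the Jacobian `r ^ d` is `r ^ (2p-2) · r`, and
the last factor is grouped with the defect because their product converges. -/
lemma poissonIntensity_coverSet_diff (hc : Convex ℝ K) (hK : IsCompact K) {p : ℝ}
    (hp : 1 / 2 < p) (z w : Rd d) {C : ℝ} (hC : 0 ≤ C) :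
    poissonIntensity d p ((coverSet K z \ coverSet K w) ∩ univ ×ˢ Icc 0 C) =
      ENNReal.ofReal (∫ r in (0)..C,
        r ^ (2 * p - 2) * (r * (shiftDefect K (r⁻¹ • (w - z))).toReal)) := by
  have hm : MeasurableSet ((coverSet K z \ coverSet K w) ∩ univ ×ˢ Icc 0 C) :=
    ((isClosed_coverSet hK z).measurableSet.diff (isClosed_coverSet hK w).measurableSet).inter
      (MeasurableSet.univ.prod measurableSet_Icc)
  have hrad := intervalIntegrable_radial hc hK hp (w - z) C hC
  rw [intervalIntegrable_iff_integrableOn_Ioc_of_le hC] at hrad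
  rw [poissonIntensity, Measure.prod_apply_symm hm,
    lintegral_withDensity_eq_lintegral_mul _ (by fun_prop) (measurable_measure_prodMk_right hm),
    intervalIntegral.integral_of_le hC, ofReal_integral_eq_lintegral_ofReal hrad,
    ← lintegral_indicator measurableSet_Ioi, ← lintegral_indicator measurableSet_Ioc]
  · refine lintegral_congr fun r => ?_
    by_cases hr : r ∈ Ioc 0 C
    · have hr0 : r ∈ Ioi (0 : ℝ) := hr.1
      have hsec : (fun x => (x, r)) ⁻¹' ((coverSet K z \ coverSet K w) ∩ univ ×ˢ Icc 0 C) =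
          {x | (x, r) ∈ coverSet K z \ coverSet K w} := by
        ext x
        simp [hr.1.le, hr.2]
      rw [indicator_of_mem hr0, indicator_of_mem hr, Pi.mul_apply, hsec,
        volume_coverSet_diff_section z w hr.1,
        ← ENNReal.ofReal_toReal (shiftDefect_lt_top hK (r⁻¹ • (w - z))).ne,
        ← ENNReal.ofReal_mul (pow_nonneg hr.1.le d),
        ← ENNReal.ofReal_mul (Real.rpow_nonneg hr.1.le _),
        ENNReal.toReal_ofReal ENNReal.toReal_nonneg]
      congr 1
      rw [← mul_assoc, ← mul_assoc]
      congr 1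
      rw [← Real.rpow_natCast r d, ← Real.rpow_add hr.1]
      nth_rw 3 [← Real.rpow_one r]
      rw [← Real.rpow_add hr.1]
      congr 1
      ring
    · rw [indicator_of_notMem hr]
      by_cases hr0 : r ∈ Ioi (0 : ℝ)
      · have hsec : (fun x => (x, r)) ⁻¹' ((coverSet K z \ coverSet K w) ∩ univ ×ˢ Icc 0 C) =
            ∅ := by
          ext x
          simp only [mem_preimage, mem_inter_iff, mem_prod, mem_univ, true_and,
            mem_empty_iff_false, iff_false, not_and]
          exact fun _ h => hr ⟨hr0, h.2⟩
        rw [indicator_of_mem hr0, Pi.mul_apply, hsec, measure_empty, mul_zero]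
      · rw [indicator_of_notMem hr0]
  · refine (ae_restrict_iff' measurableSet_Ioc).2 (ae_of_all _ fun r hr => ?_)
    exact mul_nonneg (Real.rpow_nonneg hr.1.le _) (mul_nonneg hr.1.le ENNReal.toReal_nonneg)

/-- Power-weighted Cesàro means of a bounded convergent function. -/
lemma tendsto_rpow_mul_integral {φ : ℝ → ℝ} (hφ : Measurable φ) {L B p : ℝ} (hp : 1 / 2 < p)
    (hB : ∀ r, 0 < r → |φ r| ≤ B) (hL : Tendsto φ atTop (nhds L)) :
    Tendsto (fun C : ℝ => C ^ (1 - 2 * p) * ∫ r in (0)..C, r ^ (2 * p - 2) * φ r) atTop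
      (nhds (L / (2 * p - 1))) := by
  -- Substituting `r = C s` cancels all powers of `C`, leaving a fixed weight on `[0, 1]`.
  have h1 : ∀ C : ℝ, 0 < C → C ^ (1 - 2 * p) * ∫ r in (0)..C, r ^ (2 * p - 2) * φ r =
      ∫ s in (0)..1, s ^ (2 * p - 2) * φ (C * s) := by
    intro C hC
    have h := intervalIntegral.integral_comp_mul_left (a := 0) (b := 1)
      (fun r => r ^ (2 * p - 2) * φ r) hC.ne'
    rw [mul_zero, mul_one, smul_eq_mul] at h
    have h2 : ∫ r in (0)..C, r ^ (2 * p - 2) * φ r =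
        C * ∫ s in (0)..1, (C * s) ^ (2 * p - 2) * φ (C * s) := by
      rw [h, mul_inv_cancel_left₀ hC.ne']
    rw [h2, ← mul_assoc, ← intervalIntegral.integral_const_mul]
    refine intervalIntegral.integral_congr fun s hs => ?_
    rw [uIcc_of_le zero_le_one] at hs
    rw [Real.mul_rpow hC.le hs.1, ← mul_assoc, ← mul_assoc]
    congr 1
    nth_rw 2 [← Real.rpow_one C]
    rw [← Real.rpow_add hC, ← Real.rpow_add hC]
    rw [show 1 - 2 * p + 1 + (2 * p - 2) = 0 by ring, Real.rpow_zero, one_mul]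
  have h3 : L / (2 * p - 1) = ∫ s in (0 : ℝ)..1, s ^ (2 * p - 2) * L := by
    rw [intervalIntegral.integral_mul_const, integral_rpow (Or.inl (by linarith)),
      Real.one_rpow, Real.zero_rpow (by linarith)]
    rw [show 2 * p - 2 + 1 = 2 * p - 1 by ring, sub_zero]
    ring
  rw [h3]
  have h4 : Tendsto (fun C : ℝ => ∫ s in (0)..1, s ^ (2 * p - 2) * φ (C * s)) atTop
      (nhds (∫ s in (0 : ℝ)..1, s ^ (2 * p - 2) * L)) := by
    refine intervalIntegral.tendsto_integral_filter_of_dominated_convergence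
      (fun s => s ^ (2 * p - 2) * B) ?_ ?_ ?_ ?_
    · exact Eventually.of_forall fun C => by fun_prop
    · filter_upwards [eventually_gt_atTop 0] with C hC
      refine ae_of_all _ fun s hs => ?_
      rw [uIoc_of_le zero_le_one] at hs
      rw [norm_mul, Real.norm_of_nonneg (Real.rpow_nonneg hs.1.le _)]
      exact mul_le_mul_of_nonneg_left (hB _ (mul_pos hC hs.1)) (Real.rpow_nonneg hs.1.le _)
    · exact (intervalIntegral.intervalIntegrable_rpow' (by linarith)).mul_const B
    · refine ae_of_all _ fun s hs => ?_
      rw [uIoc_of_le zero_le_one] at hs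
      exact (hL.comp (tendsto_id.atTop_mul_const hs.1)).const_mul _
  refine h4.congr' ?_
  filter_upwards [eventually_gt_atTop 0] with C hC
  rw [h1 C hC]

lemma tendsto_poissonIntensity_coverSet_diff (hc : Convex ℝ K) (hK : IsCompact K)
    (hint : (interior K).Nonempty) {p : ℝ} (hp : 1 / 2 < p) (z w : Rd d) :
    Tendsto (fun C : ℝ => C ^ (1 - 2 * p) *
      (poissonIntensity d p).real ((coverSet K z \ coverSet K w) ∩ univ ×ˢ Icc 0 C)) atTop
      (nhds (projectionNorm K (w - z) / (2 * p - 1))) := by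
  have h := tendsto_rpow_mul_integral
    (φ := fun r => r * (shiftDefect K (r⁻¹ • (w - z))).toReal) (B := projectionNorm K (w - z))
    (measurable_id.mul ((measurable_shiftDefect hK).ennreal_toReal.comp
      (measurable_inv.smul_const (w - z)))) hp
    (fun r hr => by
      rw [abs_of_nonneg (mul_nonneg hr.le ENNReal.toReal_nonneg)]
      exact mul_shiftDefect_le_projectionNorm hc hK _ hr)
    (tendsto_mul_shiftDefect hc hK hint (w - z))
  refine h.congr' ?_
  filter_upwards [eventually_gt_atTop 0] with C hC
  rw [measureReal_def, poissonIntensity_coverSet_diff hc hK hp z w hC.le, ENNReal.toReal_ofReal]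
  exact intervalIntegral.integral_nonneg hC.le fun r hr =>
    mul_nonneg (Real.rpow_nonneg hr.1 _) (mul_nonneg hr.1 ENNReal.toReal_nonneg)

end Intensity

/-! ### Centring and limiting second moments of the integrands. -/

section SecondMoments

variable {d : ℕ} {K : Set (Rd d)}

lemma measurableSet_coverSet_diff (hK : IsCompact K) (z w : Rd d) (C : ℝ) :
    MeasurableSet ((coverSet K z \ coverSet K w) ∩ univ ×ˢ Icc 0 C) :=
  ((isClosed_coverSet hK z).measurableSet.diff (isClosed_coverSet hK w).measurableSet).inter
    (MeasurableSet.univ.prod measurableSet_Icc)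

lemma poissonIntensity_coverSet_diff_ne_top (hc : Convex ℝ K) (hK : IsCompact K) {p : ℝ}
    (hp : 1 / 2 < p) (z w : Rd d) (C : ℝ) :
    poissonIntensity d p ((coverSet K z \ coverSet K w) ∩ univ ×ˢ Icc 0 C) ≠ ∞ := by
  rcases le_or_gt 0 C with hC | hC
  · rw [poissonIntensity_coverSet_diff hc hK hp z w hC]
    exact ENNReal.ofReal_ne_top
  · simp [Icc_eq_empty_of_lt hC]

/-- The truncated integrand of the field, as a simple function. -/
noncomputable def fieldSimpleFunc (K : Set (Rd d)) (C : ℝ) (z : Rd d) :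
    SimpleFunc (Rd d × ℝ) ℝ :=
  (SimpleFunc.const _ 1).restrict ((coverSet K z \ coverSet K 0) ∩ univ ×ˢ Icc 0 C) -
    (SimpleFunc.const _ 1).restrict ((coverSet K 0 \ coverSet K z) ∩ univ ×ˢ Icc 0 C)

lemma coe_fieldSimpleFunc (hK : IsCompact K) (C : ℝ) (z : Rd d) :
    ⇑(fieldSimpleFunc K C z) =
      ((coverSet K z \ coverSet K 0) ∩ univ ×ˢ Icc 0 C).indicator (fun _ => (1 : ℝ)) -
        ((coverSet K 0 \ coverSet K z) ∩ univ ×ˢ Icc 0 C).indicator (fun _ => (1 : ℝ)) := by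
  rw [fieldSimpleFunc, SimpleFunc.coe_sub,
    SimpleFunc.coe_restrict _ (measurableSet_coverSet_diff hK _ _ _),
    SimpleFunc.coe_restrict _ (measurableSet_coverSet_diff hK _ _ _)]
  rfl

lemma indicator_fieldIntegrand (hK : IsCompact K) (C : ℝ) (z : Rd d) :
    (univ ×ˢ Icc 0 C).indicator (fieldIntegrand K z) = fieldSimpleFunc K C z := by
  classical
  rw [coe_fieldSimpleFunc hK]
  ext y
  simp only [Pi.sub_apply, indicator_apply, fieldIntegrand_eq, mem_inter_iff, Set.mem_sdiff]
  by_cases h1 : y ∈ coverSet K z <;> by_cases h2 : y ∈ coverSet K 0 <;>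
    by_cases h3 : y ∈ (univ : Set (Rd d)) ×ˢ Icc (0 : ℝ) C <;> simp [h1, h2, h3]

/-- The symmetric difference of two covering events, as a function. -/
noncomputable def coverDist (K : Set (Rd d)) (C : ℝ) (z w : Rd d) : Rd d × ℝ → ℝ :=
  ((coverSet K z \ coverSet K w) ∩ univ ×ˢ Icc 0 C).indicator (fun _ => (1 : ℝ)) +
    ((coverSet K w \ coverSet K z) ∩ univ ×ˢ Icc 0 C).indicator (fun _ => (1 : ℝ))

/-- Polarization `(a-c)(b-c) = ½((a-c)² + (b-c)² - (a-b)²)`; for values in `{0, 1}` the squares are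
indicators of symmetric differences. This is the source of the fractional Brownian form of the
covariance. -/
lemma fieldSimpleFunc_mul (hK : IsCompact K) (C : ℝ) (z w : Rd d) (y : Rd d × ℝ) :
    fieldSimpleFunc K C z y * fieldSimpleFunc K C w y =
      1 / 2 * (coverDist K C z 0 y + coverDist K C w 0 y - coverDist K C z w y) := by
  classical
  rw [coe_fieldSimpleFunc hK, coe_fieldSimpleFunc hK]
  simp only [coverDist, Pi.sub_apply, Pi.add_apply, indicator_apply, mem_inter_iff, Set.mem_sdiff]
  by_cases h1 : y ∈ coverSet K z <;> by_cases h2 : y ∈ coverSet K 0 <;>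
    by_cases h4 : y ∈ coverSet K w <;>
    by_cases h3 : y ∈ (univ : Set (Rd d)) ×ˢ Icc (0 : ℝ) C <;> norm_num [h1, h2, h3, h4]

lemma abs_fieldSimpleFunc_le (hK : IsCompact K) (C : ℝ) (z : Rd d) (y : Rd d × ℝ) :
    |fieldSimpleFunc K C z y| ≤ 1 := by
  classical
  rw [coe_fieldSimpleFunc hK]
  simp only [Pi.sub_apply, indicator_apply, mem_inter_iff, Set.mem_sdiff]
  by_cases h1 : y ∈ coverSet K z <;> by_cases h2 : y ∈ coverSet K 0 <;>
    by_cases h3 : y ∈ (univ : Set (Rd d)) ×ˢ Icc (0 : ℝ) C <;> norm_num [h1, h2, h3]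

variable {p : ℝ}

lemma integrable_indicator_coverSet_diff (hc : Convex ℝ K) (hK : IsCompact K) (hp : 1 / 2 < p)
    (z w : Rd d) (C : ℝ) :
    Integrable (((coverSet K z \ coverSet K w) ∩ univ ×ˢ Icc 0 C).indicator fun _ => (1 : ℝ))
      (poissonIntensity d p) :=
  (integrable_indicator_iff (measurableSet_coverSet_diff hK z w C)).2
    (integrableOn_const (poissonIntensity_coverSet_diff_ne_top hc hK hp z w C))

lemma integrable_fieldSimpleFunc (hc : Convex ℝ K) (hK : IsCompact K) (hp : 1 / 2 < p)
    (z : Rd d) (C : ℝ) : Integrable (fieldSimpleFunc K C z) (poissonIntensity d p) := by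
  rw [coe_fieldSimpleFunc hK]
  exact (integrable_indicator_coverSet_diff hc hK hp _ _ C).sub
    (integrable_indicator_coverSet_diff hc hK hp _ _ C)

lemma integrable_coverDist (hc : Convex ℝ K) (hK : IsCompact K) (hp : 1 / 2 < p)
    (z w : Rd d) (C : ℝ) : Integrable (coverDist K C z w) (poissonIntensity d p) :=
  (integrable_indicator_coverSet_diff hc hK hp _ _ C).add
    (integrable_indicator_coverSet_diff hc hK hp _ _ C)

lemma integral_indicator_coverSet_diff (hK : IsCompact K) (z w : Rd d) (C : ℝ) :
    ∫ y, ((coverSet K z \ coverSet K w) ∩ univ ×ˢ Icc 0 C).indicator (fun _ => (1 : ℝ)) y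
      ∂(poissonIntensity d p) =
      (poissonIntensity d p).real ((coverSet K z \ coverSet K w) ∩ univ ×ˢ Icc 0 C) := by
  rw [integral_indicator (measurableSet_coverSet_diff hK z w C)]
  simp

/-- The two one-sided differences have equal intensity since the shift defect is even. Hence the
limit needs no centring. -/
lemma integral_fieldSimpleFunc (hc : Convex ℝ K) (hK : IsCompact K) (hp : 1 / 2 < p)
    (z : Rd d) {C : ℝ} (hC : 0 ≤ C) :
    ∫ y, fieldSimpleFunc K C z y ∂(poissonIntensity d p) = 0 := by
  rw [coe_fieldSimpleFunc hK]
  simp only [Pi.sub_apply]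
  rw [integral_sub (integrable_indicator_coverSet_diff hc hK hp _ _ C)
    (integrable_indicator_coverSet_diff hc hK hp _ _ C), integral_indicator_coverSet_diff hK,
    integral_indicator_coverSet_diff hK, measureReal_def, measureReal_def,
    poissonIntensity_coverSet_diff hc hK hp _ _ hC, poissonIntensity_coverSet_diff hc hK hp _ _ hC,
    sub_eq_zero]
  congr 3
  ext r
  rw [zero_sub, smul_neg, shiftDefect_neg hK, sub_zero]

/-- The two sides contribute `1/(2p-1)` each, which gives the factor `1/(p - 1/2)` and so the
dilation of the star body. -/
lemma tendsto_integral_coverDist (hc : Convex ℝ K) (hK : IsCompact K)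
    (hint : (interior K).Nonempty) (hp : 1 / 2 < p) (z w : Rd d) :
    Tendsto (fun C : ℝ => C ^ (1 - 2 * p) *
      ∫ y, coverDist K C z w y ∂(poissonIntensity d p)) atTop
      (nhds (projectionNorm K (z - w) / (p - 1 / 2))) := by
  have h1 := tendsto_poissonIntensity_coverSet_diff hc hK hint hp z w
  have h2 := tendsto_poissonIntensity_coverSet_diff hc hK hint hp w z
  rw [← neg_sub z w, projectionNorm_neg hc hK hint] at h1
  have h3 : projectionNorm K (z - w) / (p - 1 / 2) =
      projectionNorm K (z - w) / (2 * p - 1) + projectionNorm K (z - w) / (2 * p - 1) := by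
    rw [show 2 * p - 1 = 2 * (p - 1 / 2) by ring]
    have : p - 1 / 2 ≠ 0 := by linarith
    field_simp
    ring
  rw [h3]
  refine (h1.add h2).congr fun C => ?_
  simp only [coverDist, Pi.add_apply]
  rw [integral_add (integrable_indicator_coverSet_diff hc hK hp _ _ C)
    (integrable_indicator_coverSet_diff hc hK hp _ _ C), integral_indicator_coverSet_diff hK,
    integral_indicator_coverSet_diff hK, mul_add]

/-- The covariance of the limiting field. -/
noncomputable def limitCovariance (K : Set (Rd d)) (p : ℝ) (z w : Rd d) : ℝ :=
  1 / 2 * (projectionNorm K z / (p - 1 / 2) + projectionNorm K w / (p - 1 / 2) -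
    projectionNorm K (z - w) / (p - 1 / 2))

lemma integrable_fieldSimpleFunc_mul (hc : Convex ℝ K) (hK : IsCompact K) (hp : 1 / 2 < p)
    (z w : Rd d) (C : ℝ) :
    Integrable (fun y => fieldSimpleFunc K C z y * fieldSimpleFunc K C w y)
      (poissonIntensity d p) := by
  simp only [fieldSimpleFunc_mul hK]
  exact (((integrable_coverDist hc hK hp _ _ C).add (integrable_coverDist hc hK hp _ _ C)).sub
    (integrable_coverDist hc hK hp _ _ C)).const_mul _

lemma tendsto_integral_fieldSimpleFunc_mul (hc : Convex ℝ K) (hK : IsCompact K)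
    (hint : (interior K).Nonempty) (hp : 1 / 2 < p) (z w : Rd d) :
    Tendsto (fun C : ℝ => C ^ (1 - 2 * p) *
      ∫ y, fieldSimpleFunc K C z y * fieldSimpleFunc K C w y ∂(poissonIntensity d p)) atTop
      (nhds (limitCovariance K p z w)) := by
  have h1 := tendsto_integral_coverDist hc hK hint hp z 0
  have h2 := tendsto_integral_coverDist hc hK hint hp w 0
  have h3 := tendsto_integral_coverDist hc hK hint hp z w
  rw [sub_zero] at h1 h2
  refine (((h1.add h2).sub h3).const_mul (1 / 2)).congr fun C => ?_
  simp only [fieldSimpleFunc_mul hK]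
  rw [integral_const_mul, integral_sub _ (integrable_coverDist hc hK hp _ _ C),
    integral_add (integrable_coverDist hc hK hp _ _ C) (integrable_coverDist hc hK hp _ _ C)]
  · ring
  · exact (integrable_coverDist hc hK hp _ _ C).add (integrable_coverDist hc hK hp _ _ C)

lemma SimpleFunc.finsetSum_apply {α ι : Type*} [MeasurableSpace α] (s : Finset ι)
    (f : ι → SimpleFunc α ℝ) (x : α) : (∑ i ∈ s, f i) x = ∑ i ∈ s, f i x := by
  classical
  induction s using Finset.induction_on with
  | empty => simp
  | insert i s hi ih => rw [Finset.sum_insert hi, Finset.sum_insert hi, SimpleFunc.coe_add,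
      Pi.add_apply, ih]

/-- The integrand of a linear combination of values of the truncated field. -/
noncomputable def combSimpleFunc {ι : Type*} (K : Set (Rd d)) (s : Finset ι) (c : ι → ℝ)
    (z : ι → Rd d) (C : ℝ) : SimpleFunc (Rd d × ℝ) ℝ :=
  ∑ i ∈ s, c i • fieldSimpleFunc K C (z i)

variable {ι : Type*} (s : Finset ι) (c : ι → ℝ) (z : ι → Rd d)

lemma combSimpleFunc_apply (C : ℝ) (y : Rd d × ℝ) :
    combSimpleFunc K s c z C y = ∑ i ∈ s, c i * fieldSimpleFunc K C (z i) y := by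
  rw [combSimpleFunc, SimpleFunc.finsetSum_apply]
  rfl

lemma integrable_combSimpleFunc (hc : Convex ℝ K) (hK : IsCompact K) (hp : 1 / 2 < p) (C : ℝ) :
    Integrable (combSimpleFunc K s c z C) (poissonIntensity d p) := by
  have : ⇑(combSimpleFunc K s c z C) = fun y => ∑ i ∈ s, c i * fieldSimpleFunc K C (z i) y :=
    funext fun y => combSimpleFunc_apply s c z C y
  rw [this]
  exact integrable_finsetSum _ fun i _ => (integrable_fieldSimpleFunc hc hK hp _ C).const_mul _

lemma abs_combSimpleFunc_le (hK : IsCompact K) (C : ℝ) (y : Rd d × ℝ) :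
    |combSimpleFunc K s c z C y| ≤ ∑ i ∈ s, |c i| := by
  rw [combSimpleFunc_apply]
  refine (Finset.abs_sum_le_sum_abs _ _).trans (Finset.sum_le_sum fun i _ => ?_)
  rw [abs_mul]
  exact mul_le_of_le_one_right (abs_nonneg _) (abs_fieldSimpleFunc_le hK C _ y)

lemma integral_combSimpleFunc (hc : Convex ℝ K) (hK : IsCompact K) (hp : 1 / 2 < p) {C : ℝ}
    (hC : 0 ≤ C) : ∫ y, combSimpleFunc K s c z C y ∂(poissonIntensity d p) = 0 := by
  simp only [combSimpleFunc_apply]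
  rw [integral_finsetSum _ fun i _ => (integrable_fieldSimpleFunc hc hK hp _ C).const_mul _]
  refine Finset.sum_eq_zero fun i _ => ?_
  rw [integral_const_mul, integral_fieldSimpleFunc hc hK hp _ hC, mul_zero]

lemma tendsto_integral_combSimpleFunc_sq (hc : Convex ℝ K) (hK : IsCompact K)
    (hint : (interior K).Nonempty) (hp : 1 / 2 < p) :
    Tendsto (fun C : ℝ => C ^ (1 - 2 * p) *
      ∫ y, combSimpleFunc K s c z C y ^ 2 ∂(poissonIntensity d p)) atTop
      (nhds (∑ i ∈ s, ∑ j ∈ s, c i * c j * limitCovariance K p (z i) (z j))) := by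
  refine (tendsto_finsetSum s fun i _ => tendsto_finsetSum s fun j _ =>
    (tendsto_integral_fieldSimpleFunc_mul hc hK hint hp (z i) (z j)).const_mul
      (c i * c j)).congr fun C => ?_
  have h : ∀ y, combSimpleFunc K s c z C y ^ 2 = ∑ i ∈ s, ∑ j ∈ s, c i * c j *
      (fieldSimpleFunc K C (z i) y * fieldSimpleFunc K C (z j) y) := fun y => by
    rw [combSimpleFunc_apply, sq, Finset.sum_mul_sum]
    exact Finset.sum_congr rfl fun i _ => Finset.sum_congr rfl fun j _ => by ring
  simp only [h]
  have hi := integrable_fieldSimpleFunc_mul (p := p) hc hK hp (C := C)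
  rw [integral_finsetSum _ fun i _ => integrable_finsetSum _ fun j _ => (hi _ _).const_mul _,
    Finset.mul_sum]
  refine Finset.sum_congr rfl fun i _ => ?_
  rw [integral_finsetSum _ fun j _ => (hi _ _).const_mul _, Finset.mul_sum]
  refine Finset.sum_congr rfl fun j _ => ?_
  rw [integral_const_mul]
  ring

/-- The quadratic form is a limit of rescaled integrals of squares. -/
lemma sum_limitCovariance_nonneg (hc : Convex ℝ K) (hK : IsCompact K)
    (hint : (interior K).Nonempty) (hp : 1 / 2 < p) :
    0 ≤ ∑ i ∈ s, ∑ j ∈ s, c i * c j * limitCovariance K p (z i) (z j) := by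
  refine ge_of_tendsto (tendsto_integral_combSimpleFunc_sq s c z hc hK hint hp) ?_
  filter_upwards [eventually_ge_atTop 0] with C hC
  exact mul_nonneg (Real.rpow_nonneg hC _) (integral_nonneg fun y => sq_nonneg _)

lemma limitCovariance_comm (hc : Convex ℝ K) (hK : IsCompact K) (hint : (interior K).Nonempty)
    (z w : Rd d) : limitCovariance K p z w = limitCovariance K p w z := by
  rw [limitCovariance, limitCovariance, ← neg_sub w z, projectionNorm_neg hc hK hint]
  ring

end SecondMoments

/-! ### Second-order expansion of exponents and convergence through characteristic functions. -/

/-- The cubic remainder is written `|x| * x ^ 2` so that one factor can be bounded uniformly and the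
square integrated. -/
lemma norm_exp_mul_I_sub_le {x : ℝ} (hx : |x| ≤ 1) :
    ‖Complex.exp (x * Complex.I) - 1 - x * Complex.I + (x ^ 2 / 2 : ℝ)‖ ≤ |x| * x ^ 2 := by
  have h := Complex.exp_bound (x := x * Complex.I) (by simpa using hx) (n := 3) (by norm_num)
  have h1 : Complex.exp (x * Complex.I) - 1 - x * Complex.I + (x ^ 2 / 2 : ℝ) =
      Complex.exp (x * Complex.I) - ∑ m ∈ Finset.range 3, (x * Complex.I) ^ m / m.factorial := by
    simp [Finset.sum_range_succ, mul_pow]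
    ring
  rw [h1]
  refine h.trans ?_
  rw [norm_mul, Complex.norm_I, mul_one, Complex.norm_real, Real.norm_eq_abs]
  have h2 : |x| * x ^ 2 = |x| ^ 3 := by rw [← sq_abs x]; ring
  rw [h2]
  refine mul_le_of_le_one_right (by positivity) ?_
  norm_num [Nat.factorial]

/-- Second-order expansion of the exponent of an infinitely divisible law without drift. -/
lemma norm_integral_exp_sub_one_add_le {S : Type*} [MeasurableSpace S] {ν : Measure S}
    {f : S → ℝ} (hf : Integrable f ν) (h0 : ∫ x, f x ∂ν = 0) {M a : ℝ} (hM : ∀ x, |f x| ≤ M)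
    (ha : 0 ≤ a) (haM : a * M ≤ 1) :
    ‖∫ x, (Complex.exp ((a * f x : ℝ) * Complex.I) - 1) ∂ν +
      ((a ^ 2 * ∫ x, f x ^ 2 ∂ν) / 2 : ℝ)‖ ≤ a * M * (a ^ 2 * ∫ x, f x ^ 2 ∂ν) := by
  have hsq : Integrable (fun x => f x ^ 2) ν := by
    have := hf.mul_bdd (c := M) hf.aestronglyMeasurable (ae_of_all _ hM)
    simpa [sq] using this
  have hfa : Integrable (fun x => ((a * f x : ℝ) : ℂ) * Complex.I) ν :=
    (hf.const_mul a).ofReal.mul_const _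
  have hexp : Integrable (fun x => Complex.exp ((a * f x : ℝ) * Complex.I) - 1) ν := by
    refine (hf.const_mul a).mono ?_ (ae_of_all _ fun x => ?_)
    · have := hf.aestronglyMeasurable
      fun_prop
    · rw [mul_comm _ Complex.I]
      exact Real.norm_exp_I_mul_ofReal_sub_one_le
  have hsqc : Integrable (fun x => (((a * f x) ^ 2 / 2 : ℝ) : ℂ)) ν := by
    have h : Integrable (fun x => ((a ^ 2 / 2 * f x ^ 2 : ℝ) : ℂ)) ν :=
      (hsq.const_mul (a ^ 2 / 2)).ofReal
    refine h.congr (ae_of_all _ fun x => ?_)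
    beta_reduce
    rw [show a ^ 2 / 2 * f x ^ 2 = (a * f x) ^ 2 / 2 by ring]
  have hfa0 : ∫ x, ((a * f x : ℝ) : ℂ) * Complex.I ∂ν = 0 := by
    rw [integral_mul_const, integral_complex_ofReal, integral_const_mul, h0]
    simp
  have hsq1 : ∫ x, (((a * f x) ^ 2 / 2 : ℝ) : ℂ) ∂ν = ((a ^ 2 * ∫ x, f x ^ 2 ∂ν) / 2 : ℝ) := by
    rw [integral_complex_ofReal, ← integral_const_mul, ← integral_div]
    congr 2
    ext x
    ring
  have heq : ∫ x, (Complex.exp ((a * f x : ℝ) * Complex.I) - 1) ∂ν +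
      ((a ^ 2 * ∫ x, f x ^ 2 ∂ν) / 2 : ℝ) =
      ∫ x, (Complex.exp ((a * f x : ℝ) * Complex.I) - 1 - (a * f x : ℝ) * Complex.I +
        (((a * f x) ^ 2 / 2 : ℝ) : ℂ)) ∂ν := by
    have h := integral_add (hexp.sub hfa) hsqc
    simp only [Pi.sub_apply] at h
    rw [h, integral_sub hexp hfa, hfa0, hsq1, sub_zero]
  rw [heq, ← integral_const_mul, ← integral_const_mul]
  refine norm_integral_le_of_norm_le ((hsq.const_mul _).const_mul _) (ae_of_all _ fun x => ?_)
  have habs : |a * f x| ≤ a * M := by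
    rw [abs_mul, abs_of_nonneg ha]
    exact mul_le_mul_of_nonneg_left (hM x) ha
  refine (norm_exp_mul_I_sub_le (habs.trans haM)).trans ?_
  rw [← mul_pow]
  exact mul_le_mul_of_nonneg_right habs (sq_nonneg _)

lemma charFun_map_toLp {Ω : Type*} [MeasurableSpace Ω] {P : Measure Ω} {k : ℕ}
    {X : Fin k → Ω → ℝ} (hX : ∀ i, AEMeasurable (X i) P) (t : EuclideanSpace ℝ (Fin k)) :
    charFun (P.map fun ω => WithLp.toLp 2 fun i => X i ω) t =
      ∫ ω, Complex.exp ((∑ i, t i * X i ω : ℝ) * Complex.I) ∂P := by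
  have hm : AEMeasurable (fun ω => WithLp.toLp 2 fun i => X i ω) P :=
    (PiLp.continuous_toLp 2 _).measurable.comp_aemeasurable (aemeasurable_pi_lambda _ hX)
  rw [charFun_apply, integral_map hm (by fun_prop)]
  simp [PiLp.inner_apply]

/-- Convergence of characteristic functions implies convergence in distribution, for random
vectors depending on a real parameter. -/
lemma tendstoInDistribution_pi_of_tendsto_charFun {Ω Ω' : Type*} [MeasurableSpace Ω]
    [MeasurableSpace Ω'] {P : Measure Ω} [IsProbabilityMeasure P] {P' : Measure Ω'}
    [IsProbabilityMeasure P'] {k : ℕ} {Y : ℝ → Fin k → Ω → ℝ} {X : Fin k → Ω' → ℝ}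
    (hY : ∀ C i, AEMeasurable (Y C i) P) (hX : ∀ i, AEMeasurable (X i) P')
    (h : ∀ t : Fin k → ℝ, Tendsto
      (fun C => ∫ ω, Complex.exp ((∑ i, t i * Y C i ω : ℝ) * Complex.I) ∂P) atTop
      (nhds (∫ ω, Complex.exp ((∑ i, t i * X i ω : ℝ) * Complex.I) ∂P'))) :
    TendstoInDistribution (fun C ω i => Y C i ω) atTop (fun ω i => X i ω) (fun _ => P) P' := by
  have hcont := (PiLp.continuous_toLp 2 fun _ : Fin k => ℝ).measurable
  -- Characteristic functions need an inner product, so vectors are first placed in Euclidean space;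
  -- Lévy's theorem is applied along each sequence tending to infinity.
  have hE : TendstoInDistribution (fun C ω => WithLp.toLp 2 fun i => Y C i ω) atTop
      (fun ω => WithLp.toLp 2 fun i => X i ω) (fun _ => P) P' := by
    refine ⟨fun C => hcont.comp_aemeasurable (aemeasurable_pi_lambda _ (hY C)),
      hcont.comp_aemeasurable (aemeasurable_pi_lambda _ hX), ?_⟩
    refine tendsto_iff_seq_tendsto.2 fun u hu => ?_
    refine ProbabilityMeasure.tendsto_of_tendsto_charFun fun t => ?_
    simp only [ProbabilityMeasure.coe_mk]
    rw [charFun_map_toLp hX]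
    refine ((h t).comp hu).congr fun n => ?_
    exact (charFun_map_toLp (hY (u n)) t).symm
  exact hE.continuous_comp (PiLp.continuous_ofLp 2 _)

/-- The characteristic function of a linear combination of values of a centred Gaussian process. -/
lemma integral_exp_sum_of_isGaussianProcess {T Ω : Type*} [MeasurableSpace Ω] {P : Measure Ω}
    [IsProbabilityMeasure P] {X : T → Ω → ℝ} (hX : IsGaussianProcess X P)
    (h0 : ∀ z, ∫ ω, X z ω ∂P = 0) {k : T → T → ℝ} (hk : ∀ z w, ∫ ω, X z ω * X w ω ∂P = k z w)
    {ι : Type*} [Fintype ι] (c : ι → ℝ) (z : ι → T) :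
    ∫ ω, Complex.exp ((∑ i, c i * X (z i) ω : ℝ) * Complex.I) ∂P =
      Complex.exp (-((∑ i, ∑ j, c i * c j * k (z i) (z j)) / 2 : ℝ)) := by
  classical
  -- The points `z i` may coincide, so the joint Gaussian law is taken over the set of distinct
  -- ones.
  let I : Finset T := Finset.univ.image z
  have hzI : ∀ i, z i ∈ I := fun i => Finset.mem_image_of_mem z (Finset.mem_univ i)
  let L : (I → ℝ) →L[ℝ] ℝ := ∑ i, c i • ContinuousLinearMap.proj ⟨z i, hzI i⟩
  have hmem : ∀ t, MemLp (X t) 2 P := fun t => (hX.hasGaussianLaw_eval t).memLp_two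
  have hY : HasGaussianLaw (fun ω => ∑ i, c i * X (z i) ω) P := by
    have hL : (fun ω => ∑ i, c i * X (z i) ω) = fun ω => L (I.restrict fun t => X t ω) := by
      ext ω
      simp [L]
    rw [hL]
    exact (hX.hasGaussianLaw I).map_fun L
  have hmean : ∫ ω, ∑ i, c i * X (z i) ω ∂P = 0 := by
    rw [integral_finsetSum _ fun i _ => ((hmem _).integrable (by norm_num)).const_mul _]
    exact Finset.sum_eq_zero fun i _ => by rw [integral_const_mul, h0, mul_zero]
  have hvar : Var[fun ω => ∑ i, c i * X (z i) ω; P] =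
      ∑ i, ∑ j, c i * c j * k (z i) (z j) := by
    rw [variance_eq_integral hY.aemeasurable, hmean]
    have h : ∀ ω, (∑ i, c i * X (z i) ω - 0) ^ 2 =
        ∑ i, ∑ j, c i * c j * (X (z i) ω * X (z j) ω) := fun ω => by
      rw [sub_zero, sq, Finset.sum_mul_sum]
      exact Finset.sum_congr rfl fun i _ => Finset.sum_congr rfl fun j _ => by ring
    have hi : ∀ i j, Integrable (fun ω => c i * c j * (X (z i) ω * X (z j) ω)) P := fun i j =>
      ((hmem _).integrable_mul (hmem _)).const_mul _
    simp only [h]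
    rw [integral_finsetSum _ fun i _ => integrable_finsetSum _ fun j _ => hi i j]
    refine Finset.sum_congr rfl fun i _ => ?_
    rw [integral_finsetSum _ fun j _ => hi i j]
    exact Finset.sum_congr rfl fun j _ => by rw [integral_const_mul, hk]
  have h1 : ∫ ω, Complex.exp ((∑ i, c i * X (z i) ω : ℝ) * Complex.I) ∂P =
      charFun (P.map fun ω => ∑ i, c i * X (z i) ω) 1 := by
    rw [charFun_apply_real, integral_map hY.aemeasurable (by fun_prop)]
    simp
  rw [h1, hY.map_eq_gaussianReal, charFun_gaussianReal, hmean, hvar, Real.coe_toNNReal]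
  · congr 1
    push_cast
    ring
  · rw [← hvar]
    exact variance_nonneg _ _

/-! ### Characteristic functions of the rescaled Poisson field and their limit. -/

section TruncatedField

variable {d : ℕ} {K : Set (Rd d)} {p : ℝ} {Ω : Type*} [MeasurableSpace Ω] {P : Measure Ω}
  {N : Ω → Measure (Rd d × ℝ)}

lemma measurableSet_slab (C : ℝ) : MeasurableSet ((univ : Set (Rd d)) ×ˢ Icc (0 : ℝ) C) :=
  MeasurableSet.univ.prod measurableSet_Icc

lemma truncatedField_eq {Ω : Type*} {N : Ω → Measure (Rd d × ℝ)} (hK : IsCompact K) (C : ℝ) (z : Rd d) (ω : Ω) :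
    truncatedField K N C z ω = ∫ y, fieldSimpleFunc K C z y ∂(N ω) := by
  rw [truncatedField, ← integral_indicator (measurableSet_slab C), indicator_fieldIntegrand hK]

lemma ae_integrableOn_fieldIntegrand (hN : IsPoissonProcess N (poissonIntensity d p) P)
    (hc : Convex ℝ K) (hK : IsCompact K) (hp : 1 / 2 < p) (C : ℝ) (z : Rd d) :
    ∀ᵐ ω ∂P, IntegrableOn (fieldIntegrand K z) (univ ×ˢ Icc 0 C) (N ω) := by
  filter_upwards [hN.ae_integrable_simpleFunc (integrable_fieldSimpleFunc hc hK hp z C)] with ω hω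
  rwa [← integrable_indicator_iff (measurableSet_slab C), indicator_fieldIntegrand hK]

lemma aemeasurable_truncatedField (hN : IsPoissonProcess N (poissonIntensity d p) P)
    (hc : Convex ℝ K) (hK : IsCompact K) (hp : 1 / 2 < p) (C : ℝ) (z : Rd d) :
    AEMeasurable (truncatedField K N C z) P := by
  have := hN.aemeasurable_integral_simpleFunc (integrable_fieldSimpleFunc hc hK hp z C)
  exact this.congr (ae_of_all _ fun ω => (truncatedField_eq hK C z ω).symm)

lemma integral_exp_sum_truncatedField [IsProbabilityMeasure P]
    (hN : IsPoissonProcess N (poissonIntensity d p) P)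
    (hc : Convex ℝ K) (hK : IsCompact K) (hp : 1 / 2 < p) {ι : Type*} [Fintype ι] (c : ι → ℝ)
    (z : ι → Rd d) (C a : ℝ) :
    ∫ ω, Complex.exp ((∑ i, c i * (a * truncatedField K N C (z i) ω) : ℝ) * Complex.I) ∂P =
      Complex.exp (∫ y, (Complex.exp ((a * combSimpleFunc K Finset.univ c z C y : ℝ) *
        Complex.I) - 1) ∂(poissonIntensity d p)) := by
  have hf := integrable_combSimpleFunc Finset.univ c z hc hK hp C
  have h := hN.integral_exp_integral_simpleFunc
    (f := a • combSimpleFunc K Finset.univ c z C) (by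
      rw [SimpleFunc.coe_smul]
      exact hf.smul a)
  simp only [SimpleFunc.coe_smul, Pi.smul_apply, smul_eq_mul] at h
  rw [← h]
  refine integral_congr_ae ?_
  -- Almost sure integrability of every term lets the linear combination of integrals become one
  -- integral.
  have hint : ∀ i, ∀ᵐ ω ∂P, Integrable (fieldSimpleFunc K C (z i)) (N ω) := fun i =>
    hN.ae_integrable_simpleFunc (integrable_fieldSimpleFunc hc hK hp (z i) C)
  filter_upwards [ae_all_iff.2 hint] with ω hω
  congr 3
  simp only [combSimpleFunc_apply]
  rw [integral_const_mul, integral_finsetSum _ fun i _ => (hω i).const_mul _, Finset.mul_sum]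
  refine Finset.sum_congr rfl fun i _ => ?_
  rw [integral_const_mul, truncatedField_eq hK]
  ring

/-- With `a = C ^ (1/2 - p)`, the square `a²` is exactly the normalisation `C ^ (1 - 2p)` of the
second moment, while the Taylor error carries an extra factor `a M → 0`. -/
lemma tendsto_integral_exp_sum_truncatedField [IsProbabilityMeasure P]
    (hN : IsPoissonProcess N (poissonIntensity d p) P)
    (hc : Convex ℝ K) (hK : IsCompact K) (hint : (interior K).Nonempty) (hp : 1 / 2 < p)
    {ι : Type*} [Fintype ι] (c : ι → ℝ) (z : ι → Rd d) :
    Tendsto (fun C : ℝ => ∫ ω, Complex.exp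
      ((∑ i, c i * (C ^ (1 / 2 - p) * truncatedField K N C (z i) ω) : ℝ) * Complex.I) ∂P) atTop
      (nhds (Complex.exp
        (-((∑ i, ∑ j, c i * c j * limitCovariance K p (z i) (z j)) / 2 : ℝ)))) := by
  set V := ∑ i, ∑ j, c i * c j * limitCovariance K p (z i) (z j)
  set M := ∑ i, |c i|
  have hQ := tendsto_integral_combSimpleFunc_sq Finset.univ c z hc hK hint hp
  have ha : Tendsto (fun C : ℝ => C ^ (1 / 2 - p)) atTop (nhds 0) := by
    have := tendsto_rpow_neg_atTop (y := p - 1 / 2) (by linarith)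
    simpa using this
  have hQ2 : Tendsto (fun C : ℝ => (C ^ (1 / 2 - p)) ^ 2 *
      ∫ y, combSimpleFunc K Finset.univ c z C y ^ 2 ∂(poissonIntensity d p)) atTop (nhds V) := by
    refine hQ.congr' ?_
    filter_upwards [eventually_gt_atTop 0] with C hC
    rw [← Real.rpow_natCast, ← Real.rpow_mul hC.le]
    congr 2
    push_cast
    ring
  simp only [integral_exp_sum_truncatedField hN hc hK hp]
  refine (Complex.continuous_exp.tendsto _).comp ?_
  have haM : Tendsto (fun C : ℝ => C ^ (1 / 2 - p) * M) atTop (nhds 0) := by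
    simpa using ha.mul_const M
  have herr : Tendsto (fun C : ℝ => ∫ y, (Complex.exp ((C ^ (1 / 2 - p) *
      combSimpleFunc K Finset.univ c z C y : ℝ) * Complex.I) - 1) ∂(poissonIntensity d p) +
      (((C ^ (1 / 2 - p)) ^ 2 * ∫ y, combSimpleFunc K Finset.univ c z C y ^ 2
        ∂(poissonIntensity d p)) / 2 : ℝ)) atTop (nhds 0) := by
    have hbound := haM.mul hQ2
    rw [zero_mul] at hbound
    refine squeeze_zero_norm' ?_ hbound
    filter_upwards [eventually_gt_atTop 0, haM.eventually (ge_mem_nhds one_pos)] with C hC hC1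
    exact norm_integral_exp_sub_one_add_le (integrable_combSimpleFunc _ c z hc hK hp C)
      (integral_combSimpleFunc _ c z hc hK hp hC.le)
      (abs_combSimpleFunc_le _ c z hK C) (Real.rpow_nonneg hC.le _) hC1
  have h2 := herr.sub ((Complex.continuous_ofReal.tendsto _).comp (hQ2.div_const 2))
  simp only [Function.comp_def, add_sub_cancel_right, zero_sub] at h2
  exact h2

end TruncatedField

/-- For `H = 1/2` the exponent `2H` is `1`, so the gauge enters linearly. -/
lemma gauge_covariance_eq_limitCovariance {d : ℕ} {K : Set (Rd d)} (hc : Convex ℝ K)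
    (hK : IsCompact K) (hint : (interior K).Nonempty) {p : ℝ} (hp : 1 / 2 < p) (z w : Rd d) :
    1 / 2 * (gauge ((p - 1 / 2) • polarProjectionBody K) z ^ (2 * (1 / 2) : ℝ) +
      gauge ((p - 1 / 2) • polarProjectionBody K) w ^ (2 * (1 / 2) : ℝ) -
      gauge ((p - 1 / 2) • polarProjectionBody K) (z - w) ^ (2 * (1 / 2) : ℝ)) =
    limitCovariance K p z w := by
  have hp0 : 0 < p - 1 / 2 := by linarith
  simp only [gauge_smul_polarProjectionBody hc hK hint hp0, limitCovariance]
  norm_num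

theorem theorem4 {d : ℕ} (hd : 1 ≤ d) (K : ConvexBody (Rd d))
    (hK : (interior (K : Set (Rd d))).Nonempty) {p : ℝ} (hp : 1 / 2 < p)
    {Ω : Type*} [MeasurableSpace Ω] (P : Measure Ω) [IsProbabilityMeasure P]
    (N : Ω → Measure (Rd d × ℝ)) (hN : IsPoissonProcess N (poissonIntensity d p) P) :
    -- the truncated field is well defined
    (∀ C : ℝ, 0 < C → ∀ z : Rd d, ∀ᵐ ω ∂P,
      IntegrableOn (fieldIntegrand (K : Set (Rd d)) z) (univ ×ˢ Icc 0 C) (N ω)) ∧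
    -- the limiting field exists
    (∃ (Ω' : Type) (_ : MeasurableSpace Ω') (P' : Measure Ω') (_ : IsProbabilityMeasure P')
      (X : Rd d → Ω' → ℝ),
      IsMfBf (1 / 2) ((p - 1 / 2) • polarProjectionBody (K : Set (Rd d))) X P') ∧
    -- convergence of the finite-dimensional distributions
    (∀ {Ω' : Type*} [MeasurableSpace Ω'] (P' : Measure Ω') [IsProbabilityMeasure P']
      (X : Rd d → Ω' → ℝ),
      IsMfBf (1 / 2) ((p - 1 / 2) • polarProjectionBody (K : Set (Rd d))) X P' →
      ∀ (k : ℕ) (z : Fin k → Rd d),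
        TendstoInDistribution
          (fun (C : ℝ) (ω : Ω) (i : Fin k) =>
            C ^ (1 / 2 - p) * truncatedField (K : Set (Rd d)) N C (z i) ω)
          atTop (fun (ω : Ω') (i : Fin k) => X (z i) ω) (fun _ => P) P') := by
  have hc := K.convex
  have hKc := K.isCompact
  have hp0 : 0 < p - 1 / 2 := by linarith
  refine ⟨fun C _ z => ae_integrableOn_fieldIntegrand hN hc hKc hp C z, ?_, ?_⟩
  · obtain ⟨Ω', mΩ', P', hP', X, hX, h0, hcov⟩ := exists_isGaussianProcess
      (limitCovariance (K : Set (Rd d)) p) (limitCovariance_comm hc hKc hK) fun c =>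
        sum_limitCovariance_nonneg c.support c id hc hKc hK hp
    exact ⟨Ω', mΩ', P', hP', X, by norm_num, by norm_num,
      isStarBody_smul_polarProjectionBody hc hKc hK hp0, hX, h0, fun z w => by
        rw [hcov, gauge_covariance_eq_limitCovariance hc hKc hK hp]⟩
  · intro Ω' _ P' _ X hX k z
    refine tendstoInDistribution_pi_of_tendsto_charFun
      (Y := fun C i ω => C ^ (1 / 2 - p) * truncatedField (K : Set (Rd d)) N C (z i) ω)
      (X := fun i => X (z i))
      (fun C i => (aemeasurable_truncatedField hN hc hKc hp C (z i)).const_mul _)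
      (fun i => hX.isGaussianProcess.aemeasurable _) fun t => ?_
    rw [integral_exp_sum_of_isGaussianProcess hX.isGaussianProcess hX.centred
      (k := limitCovariance (K : Set (Rd d)) p) fun z w => by
        rw [hX.covariance_eq, gauge_covariance_eq_limitCovariance hc hKc hK hp]]
    exact tendsto_integral_exp_sum_truncatedField hN hc hKc hK hp t z
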